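/- Let $\gamma\in[0,1)$, $\frac{1+\gamma}{2}<\alpha<1$, and let $p,N,s$ run through sequences of natural numbers with $N\to\infty$, $N=p^{1-\gamma}$ and $s=p^{1-\alpha}$ (up to rounding: $|N-p^{1-\gamma}|<1$ and $|s-p^{1-\alpha}|<1$). Model. One observes $y=X\beta+z\in\mathbb C^N$, where $X_{jk}=\frac{1}{\sqrt p}e^{-2\pi i(k-1)(j-1)/p}$ for $1\le j\le N$, $1\le k\le p$, $\beta\in\mathbb C^p$, and $z$ is a standard complex normal vector: its coordinates are independent, each of the form $x_1+ix_2$ with $x_1,x_2$ independent real $\mathcal N(0,\frac12)$ variables. Let $\mathbb P_0$ be the law of $y$ when $\beta=0$ (the hypothesis $H_0$). For $1\le\tau_1<\dots<\tau_s\le p$ and $\tilde\beta\in\mathbb C^s$ let $\mathbb P_{(\tau,\tilde\beta)}$ be the law of $y$ when $\beta_{\tau_l}=\tilde\beta_l$ for $1\le l\le s$ and all other entries of $\beta$ vanish. Put $\tau_{s+1}:=\tau_1+p$, $$\Delta(\tau)=\frac1p\min_{1\le l\le s}|\tau_{l+1}-\tau_l|,$$ and for $r>0$ $$\Gamma(p,N,s,r)=\Big\{(\tau,\tilde\beta):\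 |\tilde\beta_1|=\dots=|\tilde\beta_s|=\sqrt{\tfrac{rp\log p}{N}},\ \ \Delta(\tau)\ge\tfrac{(\log N)^2}{N}\Big\}.$$ Test. Let $q=N\lfloor\log N+1\rfloor$, $v_m=\frac{1}{\sqrt N}\sum_{j=1}^N e^{2\pi i(m-1)(j-1)/q}y_j$ and $I_m=|v_m|^2$ for $1\le m\le q$, let $\bar\Psi(t)=\mathbb P(|\zeta|\ge t)$ for a standard complex normal variable $\zeta$ (one coordinate of $z$), and $$\mathrm{HC}(t)=\frac{\sum_{m=1}^q 1_{\{\sqrt{I_m}\ge t\}}-q\bar\Psi(t)}{\sqrt{q\bar\Psi(t)(1-\bar\Psi(t))}},\qquad \mathrm{HC}^*=\sup_{1\le t\le\sqrt{\log(N/3)}}\mathrm{HC}(t).$$ The OPHC test rejects $H_0$ if and only if $\mathrm{HC}^*>(\log N)^2$. Detection boundary. Let $$\rho^*_\gamma(\alpha)=\begin{cases}(\sqrt{1-\gamma}-\sqrt{1-\alpha})^2,&\frac34+\frac\gamma4\le\alpha<1,\\ \alpha-\frac12-\frac\gamma2,&\frac{1+\gamma}{2}\le\alpha<\frac34+\frac\gamma4.\end{cases}$$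 Theorem 2.1. If $r>\rho^*_\gamma(\alpha)$ is fixed, then the OPHC test is asymptotically powerful: $$\lim_{N\to\infty}\Big(\mathbb P_0(H_0\text{ is rejected})+\sup_{(\tau,\tilde\beta)\in\Gamma(p,N,s,r)}\mathbb P_{(\tau,\tilde\beta)}(H_0\text{ is accepted})\Big)=0.$$ -/

import Mathlib

open Filter Topology MeasureTheory ProbabilityTheory

namespace OPHC

noncomputable section

/-- The standard complex normal law `CN(0, 1, 0)`: the law of `x + i y` with `x`, `y` independent
real normal variables of mean `0` and variance `1/2`. -/
def stdComplexNormal : Measure ℂ :=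
  ((gaussianReal 0 (1 / 2)).prod (gaussianReal 0 (1 / 2))).map
    (fun w : ℝ × ℝ => (w.1 : ℂ) + (w.2 : ℂ) * Complex.I)

/-- The law of a standard complex normal vector `z` in `ℂ^N` (independent coordinates). -/
def noiseLaw (N : ℕ) : Measure (Fin N → ℂ) :=
  Measure.pi (fun _ => stdComplexNormal)

/-- The extended DFT design matrix, `X_{jk} = p^{-1/2} exp(-2πi (k-1)(j-1) / p)`
(the indices `j`, `k` below start from `0`). -/
def design (N p : ℕ) : Matrix (Fin N) (Fin p) ℂ :=
  fun j k => ((1 / Real.sqrt p : ℝ) : ℂ) *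
    Complex.exp (-(2 * Real.pi * Complex.I * ((k : ℕ) : ℂ) * ((j : ℕ) : ℂ) / (p : ℂ)))

/-- The law of the observation `y = X β + z`. -/
def obsLaw (N p : ℕ) (β : Fin p → ℂ) : Measure (Fin N → ℂ) :=
  (noiseLaw N).map (fun z => (design N p).mulVec β + z)

/-- The over-sampling matrix, `U_{mj} = N^{-1/2} exp(2πi (m-1)(j-1) / q)`
(the indices `m`, `j` below start from `0`). -/
def oversampling (q N : ℕ) : Matrix (Fin q) (Fin N) ℂ :=
  fun m j => ((1 / Real.sqrt N : ℝ) : ℂ) *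
    Complex.exp (2 * Real.pi * Complex.I * ((m : ℕ) : ℂ) * ((j : ℕ) : ℂ) / (q : ℂ))

/-- The over-sampled periodogram `I_m = |v_m|²`, where `v = U y`. -/
def periodogram (q N : ℕ) (y : Fin N → ℂ) (m : Fin q) : ℝ :=
  ‖(oversampling q N).mulVec y m‖ ^ 2

/-- The tail probability `P(|z| ≥ t)` of a standard complex normal variable `z`. -/
def tail (t : ℝ) : ℝ :=
  stdComplexNormal.real {z : ℂ | t ≤ ‖z‖}

/-- The number of `m` with `√(I_m) ≥ t`. -/
def exceedances (q N : ℕ) (y : Fin N → ℂ) (t : ℝ) : ℕ :=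
  Set.ncard {m : Fin q | t ≤ Real.sqrt (periodogram q N y m)}

/-- The normalized exceedance count `HC(t)`. -/
def HC (q N : ℕ) (y : Fin N → ℂ) (t : ℝ) : ℝ :=
  ((exceedances q N y t : ℝ) - q * tail t) / Real.sqrt (q * tail t * (1 - tail t))

/-- The statistic `HC* = sup_{a ≤ t ≤ b} HC(t)`, as an extended real number. -/
def HCstar (q N : ℕ) (a b : ℝ) (y : Fin N → ℂ) : EReal :=
  ⨆ t ∈ Set.Icc a b, ((HC q N y t : ℝ) : EReal)

/-- The rejection region `{HC* > T}` of the test with over-sampling parameter `q`, interval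
`[a, b]` and threshold `T`. -/
def rejectionRegion (q N : ℕ) (a b T : ℝ) : Set (Fin N → ℂ) :=
  {y | (T : EReal) < HCstar q N a b y}

/-- The rejection region for `q = N ⌊log N + 1⌋`, `[a, b] = [1, √(log (N/3))]`, `T = (log N)²`. -/
def ophcReject (N : ℕ) : Set (Fin N → ℂ) :=
  rejectionRegion (N * ⌊Real.log N + 1⌋₊) N 1 (Real.sqrt (Real.log ((N : ℝ) / 3)))
    (Real.log N ^ 2)

/-- The gap `τ_{l+1} - τ_l` following `τ_l`, with the convention `τ_{s+1} = τ_1 + p`. -/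
def gap {p s : ℕ} (τ : Fin s → Fin p) (l : Fin s) : ℝ :=
  if h : (l : ℕ) + 1 < s then
    |((τ ⟨(l : ℕ) + 1, h⟩ : ℕ) : ℝ) - ((τ l : ℕ) : ℝ)|
  else
    |(((τ ⟨0, l.pos⟩ : ℕ) : ℝ) + p) - ((τ l : ℕ) : ℝ)|

/-- The minimum separation `Δ(τ) = (1/p) min_l |τ_{l+1} - τ_l|`. -/
def separation {p s : ℕ} (τ : Fin s → Fin p) : ℝ :=
  (1 / (p : ℝ)) * ⨅ l : Fin s, gap τ l

/-- The vector `β` of `ℂ^p` with `β_{τ_l} = b_l` and all other entries `0`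
(for injective `τ`). -/
def sparseVector {p s : ℕ} (τ : Fin s → Fin p) (b : Fin s → ℂ) : Fin p → ℂ :=
  fun k => ∑ l : Fin s, if τ l = k then b l else 0

/-- The parameter space `Γ(p, N, s, r)`: supports `τ_1 < ⋯ < τ_s` with
`Δ(τ) ≥ (log N)² / N`, and coefficients of common modulus `√(r p log p / N)`. -/
def paramSpace (p N s : ℕ) (r : ℝ) : Set ((Fin s → Fin p) × (Fin s → ℂ)) :=
  {x | StrictMono x.1 ∧
    (∀ l, ‖x.2 l‖ = Real.sqrt (r * p * Real.log p / N)) ∧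
    Real.log N ^ 2 / N ≤ separation x.1}

/-- The detection boundary `ρ*_γ(α)`. -/
def detectionBoundary (γ α : ℝ) : ℝ :=
  if 3 / 4 + γ / 4 ≤ α then (Real.sqrt (1 - γ) - Real.sqrt (1 - α)) ^ 2
  else α - 1 / 2 - γ / 2

end

end OPHC

namespace OPHC

/-! Write `L = ⌊log N + 1⌋`, so that `q = N L`. The frequencies `m / q` split into `L` residue
classes of `m` modulo `L`. Each class is an orthonormal Fourier basis up to phases, so within a
class the transformed noise is again a vector of `N` independent standard complex normals
(`measurePreserving_classMatrix`). The dependence between classes is never analysed; it only costs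
powers of `L`, hence of `log N`.

Type I error. If `HC(t) > T`, pigeonhole gives a class whose exceedance count is too large by order
`T / √L` standard deviations. Rounding the expected count `N * tail t` up to an integer leaves at
most `L N` events, each controlled by a Chernoff bound for a sum of independent indicators. With `T
= (log N)^2` the exponent has order `(log N)^(3/2)`, which beats `log (L N)`
(`obsLaw_zero_rejectionRegion_le`, `tendsto_level`).

Type II error. Chebyshev at the single level `t = √(h log p)` is enough
(`obsLaw_compl_rejectionRegion_le`). By Anderson's inequality no frequency lowers the expected
count. At the grid frequency next to each `τ_l / p`, the signal has amplitude close to `√(r log p)`,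
because separation and the decay of the Dirichlet kernel make the leakage from the other signals of
relative order `1 / log N` (`le_norm_signalMean`). Up to logarithms the expected excess is at least
`p^(1 - α - κ)` for any `κ` above the square of the positive part of `√h - √r`, while the null
fluctuation is `p^((1 - γ - h) / 2)`. A level `h < 1 - γ` at which the excess wins exists above the
detection boundary (`exists_exponents`). -/

/-! ### The standard complex normal law: density and tails -/

theorem measurable_re_add_im_I :
    Measurable (fun w : ℝ × ℝ => (w.1 : ℂ) + (w.2 : ℂ) * Complex.I) := by fun_prop

instance : IsProbabilityMeasure stdComplexNormal := by
  unfold stdComplexNormal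
  exact Measure.isProbabilityMeasure_map measurable_re_add_im_I.aemeasurable

instance (N : ℕ) : IsProbabilityMeasure (noiseLaw N) := by
  unfold noiseLaw; infer_instance

/-- The density of the standard complex normal law. -/
noncomputable def stdDensity (w : ℂ) : ENNReal :=
  ENNReal.ofReal (Real.exp (-‖w‖ ^ 2) / Real.pi)

theorem measurable_stdDensity : Measurable stdDensity := by
  unfold stdDensity; fun_prop

theorem gaussianPDF_mul_gaussianPDF (x y : ℝ) :
    gaussianPDF 0 (1 / 2) x * gaussianPDF 0 (1 / 2) y
      = ENNReal.ofReal (Real.exp (-(x ^ 2 + y ^ 2)) / Real.pi) := by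
  rw [gaussianPDF, gaussianPDF, ← ENNReal.ofReal_mul (gaussianPDFReal_nonneg _ _ _)]
  congr 1
  have h2 : √(2 * Real.pi * (((1 / 2 : NNReal)) : ℝ)) = √Real.pi := by
    congr 1; push_cast; ring
  simp only [gaussianPDFReal, h2]
  have hpi : √Real.pi * √Real.pi = Real.pi := Real.mul_self_sqrt Real.pi_pos.le
  have he : Real.exp (-(x - 0) ^ 2 / (2 * ((1 / 2 : NNReal) : ℝ)))
      * Real.exp (-(y - 0) ^ 2 / (2 * ((1 / 2 : NNReal) : ℝ))) = Real.exp (-(x ^ 2 + y ^ 2)) := by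
    rw [← Real.exp_add]; congr 1; push_cast; ring
  rw [← he]
  rw [mul_mul_mul_comm, ← mul_inv, hpi, inv_mul_eq_div]

theorem stdComplexNormal_eq_withDensity :
    stdComplexNormal = (volume : Measure ℂ).withDensity stdDensity := by
  have hv : (1 / 2 : NNReal) ≠ 0 := by norm_num
  have h1 : (gaussianReal 0 (1 / 2)).prod (gaussianReal 0 (1 / 2))
      = (volume : Measure (ℝ × ℝ)).withDensity
        (fun w => ENNReal.ofReal (Real.exp (-(w.1 ^ 2 + w.2 ^ 2)) / Real.pi)) := by
    rw [gaussianReal_of_var_ne_zero _ hv,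
      prod_withDensity (measurable_gaussianPDF _ _) (measurable_gaussianPDF _ _)]
    congr 1
    ext w
    exact gaussianPDF_mul_gaussianPDF _ _
  have h2 : (fun w : ℝ × ℝ => (w.1 : ℂ) + (w.2 : ℂ) * Complex.I)
      = Complex.measurableEquivRealProd.symm := by
    ext w
    exact (Complex.mk_eq_add_mul_I _ _).symm
  have h3 := Complex.volume_preserving_equiv_real_prod.symm
  ext s hs
  rw [stdComplexNormal, h1, Measure.map_apply measurable_re_add_im_I hs, h2,
    withDensity_apply _ (Complex.measurableEquivRealProd.symm.measurable hs),
    withDensity_apply _ hs, ← h3.setLIntegral_comp_preimage hs measurable_stdDensity]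
  refine setLIntegral_congr_fun (Complex.measurableEquivRealProd.symm.measurable hs) ?_
  intro w _
  simp only [stdDensity, Complex.sq_norm, Complex.normSq_apply]
  congr 4
  simp [Complex.measurableEquivRealProd]
  ring

theorem measurableSet_le_norm_add (t : ℝ) (b : ℂ) : MeasurableSet {z : ℂ | t ≤ ‖b + z‖} :=
  measurableSet_le measurable_const (by fun_prop)

/-- The two events are discs of equal area, so the parts outside their intersection also have equal
area. The density is radially decreasing: outside the centred disc it is at most its value at radius
`t`, inside at least that value. -/
theorem stdComplexNormal_setOf_norm_lt_le (t : ℝ) (b : ℂ) :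
    stdComplexNormal {z : ℂ | ‖b + z‖ < t} ≤ stdComplexNormal {z : ℂ | ‖z‖ < t} := by
  have hA : {z : ℂ | ‖b + z‖ < t} = Metric.ball (-b) t := by
    ext z; simp [dist_eq_norm, add_comm]
  have hB : {z : ℂ | ‖z‖ < t} = Metric.ball 0 t := by
    ext z; simp
  rw [hA, hB]
  set A := Metric.ball (-b) t
  set B := Metric.ball (0 : ℂ) t
  have mA : MeasurableSet A := Metric.isOpen_ball.measurableSet
  have mB : MeasurableSet B := Metric.isOpen_ball.measurableSet
  have hvol : volume A = volume B := by simp [A, B]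
  have hfin : volume (A ∩ B) ≠ ⊤ :=
    (measure_mono Set.inter_subset_left |>.trans_lt measure_ball_lt_top).ne
  have hdiff : volume (A \ B) = volume (B \ A) := by
    have e1 := measure_inter_add_sdiff (μ := volume) A mB
    have e2 := measure_inter_add_sdiff (μ := volume) B mA
    rw [Set.inter_comm] at e2
    rw [← e2, ← e1] at hvol
    exact (ENNReal.add_right_inj hfin).1 hvol
  rw [← measure_inter_add_sdiff A mB, ← measure_inter_add_sdiff B mA, Set.inter_comm B A]
  gcongr 1
  rw [stdComplexNormal_eq_withDensity, withDensity_apply _ (mA.diff mB),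
    withDensity_apply _ (mB.diff mA)]
  set c := ENNReal.ofReal (Real.exp (-t ^ 2) / Real.pi)
  calc ∫⁻ a in A \ B, stdDensity a ≤ ∫⁻ _ in A \ B, c := by
        refine setLIntegral_mono' (mA.diff mB) fun x hx => ?_
        have hx1 : dist x (-b) < t := hx.1
        have ht : 0 ≤ t := dist_nonneg.trans hx1.le
        have hx2 : t ≤ ‖x‖ := by simpa [B] using hx.2
        apply ENNReal.ofReal_le_ofReal
        gcongr
    _ = ∫⁻ _ in B \ A, c := by simp [hdiff]
    _ ≤ ∫⁻ a in B \ A, stdDensity a := by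
        refine setLIntegral_mono' (mB.diff mA) fun x hx => ?_
        have hx2 : ‖x‖ < t := by simpa [B] using hx.1
        apply ENNReal.ofReal_le_ofReal
        gcongr

/-- Anderson's inequality: shifting increases the tail probability. -/
theorem tail_le_stdComplexNormal_real (t : ℝ) (b : ℂ) :
    tail t ≤ stdComplexNormal.real {z : ℂ | t ≤ ‖b + z‖} := by
  have h0 : {z : ℂ | t ≤ ‖z‖} = {z : ℂ | ‖z‖ < t}ᶜ := by ext; simp
  have hb : {z : ℂ | t ≤ ‖b + z‖} = {z : ℂ | ‖b + z‖ < t}ᶜ := by ext; simp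
  have m0 : MeasurableSet {z : ℂ | ‖z‖ < t} := measurableSet_lt (by fun_prop) measurable_const
  have mb : MeasurableSet {z : ℂ | ‖b + z‖ < t} := measurableSet_lt (by fun_prop) measurable_const
  rw [tail, h0, hb, probReal_compl_eq_one_sub m0, probReal_compl_eq_one_sub mb]
  gcongr 1
  exact ENNReal.toReal_mono (measure_ne_top _ _) (stdComplexNormal_setOf_norm_lt_le t b)

/-- The event contains a unit disc centred at distance `d + 1` from the origin in the direction of
`b`. The density there is at least `exp (-(d + 2) ^ 2) / π`, and the area `π` cancels the
normalisation. The additive `2` is harmless since `t` grows. -/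
theorem exp_neg_le_stdComplexNormal_real {t : ℝ} (b : ℂ) :
    Real.exp (-(max (t - ‖b‖) 0 + 2) ^ 2) ≤ stdComplexNormal.real {z : ℂ | t ≤ ‖b + z‖} := by
  set d := max (t - ‖b‖) 0
  have hd : 0 ≤ d := le_max_right _ _
  obtain ⟨u, hu1, hu2⟩ : ∃ u : ℂ, ‖u‖ = 1 ∧ b = (‖b‖ : ℂ) * u := by
    by_cases hb : b = 0
    · exact ⟨1, by simp, by simp [hb]⟩
    · refine ⟨b / ‖b‖, ?_, ?_⟩
      · simp [hb]
      · rw [mul_div_cancel₀ _ (by simpa using hb)]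
  set c : ℂ := ((d + 1 : ℝ) : ℂ) * u
  have hc : ‖c‖ = d + 1 := by
    rw [norm_mul, hu1, mul_one, Complex.norm_real, Real.norm_of_nonneg (by linarith)]
  have hbc : ‖b + c‖ = ‖b‖ + d + 1 := by
    have : b + c = ((‖b‖ + d + 1 : ℝ) : ℂ) * u := by
      conv_lhs => rw [hu2]
      simp only [c]; push_cast; ring
    rw [this, norm_mul, hu1, mul_one, Complex.norm_real,
      Real.norm_of_nonneg (by positivity)]
  have hsub : Metric.ball c 1 ⊆ {z : ℂ | t ≤ ‖b + z‖} := by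
    intro z hz
    rw [Metric.mem_ball, dist_eq_norm] at hz
    have h1 : ‖b + c‖ ≤ ‖b + z‖ + ‖z - c‖ := by
      have := norm_sub_le (b + z) (z - c)
      rwa [show b + z - (z - c) = b + c by ring] at this
    have h2 : t - ‖b‖ ≤ d := le_max_left _ _
    simp only [Set.mem_ofPred_eq]
    linarith
  refine le_trans ?_ (measureReal_mono hsub)
  rw [Measure.real, ← ENNReal.ofReal_le_iff_le_toReal (measure_ne_top _ _),
    stdComplexNormal_eq_withDensity, withDensity_apply _ Metric.isOpen_ball.measurableSet]
  calc ENNReal.ofReal (Real.exp (-(d + 2) ^ 2))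
      = ∫⁻ _ in Metric.ball c 1, ENNReal.ofReal (Real.exp (-(d + 2) ^ 2) / Real.pi) := by
        have hpi : (NNReal.pi : ENNReal) = ENNReal.ofReal Real.pi := by
          rw [ENNReal.ofReal, ← NNReal.coe_real_pi, Real.toNNReal_coe]
        rw [lintegral_const, Measure.restrict_apply_univ, Complex.volume_ball, hpi,
          ENNReal.ofReal_one, one_pow, one_mul, ← ENNReal.ofReal_mul (by positivity),
          div_mul_cancel₀ _ Real.pi_ne_zero]
    _ ≤ ∫⁻ a in Metric.ball c 1, stdDensity a := by
        refine setLIntegral_mono' Metric.isOpen_ball.measurableSet fun x hx => ?_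
        rw [Metric.mem_ball, dist_eq_norm] at hx
        have hx2 : ‖x‖ ≤ d + 2 := by
          have := norm_add_le (x - c) c
          rw [sub_add_cancel] at this
          linarith
        apply ENNReal.ofReal_le_ofReal
        gcongr

theorem integral_Ioi_two_mul_exp_neg_sq (t : ℝ) :
    IntegrableOn (fun r : ℝ => 2 * r * Real.exp (-r ^ 2)) (Set.Ioi (max t 0)) ∧
    ∫ r in Set.Ioi (max t 0), 2 * r * Real.exp (-r ^ 2) = Real.exp (-(max t 0) ^ 2) := by
  have hd : ∀ x ∈ Set.Ici (max t 0), HasDerivAt (fun r : ℝ => -Real.exp (-r ^ 2))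
      (2 * x * Real.exp (-x ^ 2)) x := by
    intro x _
    have := ((hasDerivAt_pow 2 x).fun_neg.exp).fun_neg
    have he : 2 * x * Real.exp (-x ^ 2) = -(Real.exp (-x ^ 2) * -((2 : ℕ) * x ^ (2 - 1))) := by
      push_cast; ring
    rw [he]
    exact this
  have hpos : ∀ x ∈ Set.Ioi (max t 0), 0 ≤ 2 * x * Real.exp (-x ^ 2) := by
    intro x hx
    have : 0 < x := (le_max_right _ _).trans_lt hx
    positivity
  have hlim : Tendsto (fun r : ℝ => -Real.exp (-r ^ 2)) atTop (𝓝 0) := by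
    rw [← neg_zero]
    exact (Real.tendsto_exp_neg_atTop_nhds_zero.comp (tendsto_pow_atTop two_ne_zero)).neg
  refine ⟨integrableOn_Ioi_deriv_of_nonneg' hd hpos hlim, ?_⟩
  rw [integral_Ioi_of_hasDerivAt_of_nonneg' hd hpos hlim]
  simp

theorem tail_eq {t : ℝ} (ht : 0 ≤ t) : tail t = Real.exp (-t ^ 2) := by
  have hm : MeasurableSet {z : ℂ | t ≤ ‖z‖} := measurableSet_le measurable_const (by fun_prop)
  have hI := integral_Ioi_two_mul_exp_neg_sq t
  rw [max_eq_left ht] at hI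
  rw [tail, Measure.real, stdComplexNormal_eq_withDensity, withDensity_apply _ hm,
    ← lintegral_indicator hm, ← Complex.lintegral_comp_polarCoord_symm]
  have key : ∫⁻ (p : ℝ × ℝ) in polarCoord.target, ENNReal.ofReal p.1 •
      ({z : ℂ | t ≤ ‖z‖}.indicator stdDensity (Complex.polarCoord.symm p))
      = ENNReal.ofReal (Real.exp (-t ^ 2)) := by
    rw [polarCoord_target, Measure.volume_eq_prod, ← Measure.prod_restrict]
    set g : ℝ → ENNReal := fun r =>
      (Set.Ici t).indicator (fun r => ENNReal.ofReal (r * (Real.exp (-r ^ 2) / Real.pi))) r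
    have hg : Measurable g :=
      Measurable.indicator (by fun_prop) measurableSet_Ici
    have e1 : ∫⁻ (p : ℝ × ℝ), ENNReal.ofReal p.1 •
        ({z : ℂ | t ≤ ‖z‖}.indicator stdDensity (Complex.polarCoord.symm p))
        ∂((volume.restrict (Set.Ioi 0)).prod (volume.restrict (Set.Ioo (-Real.pi) Real.pi)))
        = ∫⁻ p : ℝ × ℝ, g p.1 * 1
        ∂((volume.restrict (Set.Ioi 0)).prod (volume.restrict (Set.Ioo (-Real.pi) Real.pi))) := by
      refine lintegral_congr_ae ?_
      have hfst : ∀ᵐ p : ℝ × ℝ ∂((volume.restrict (Set.Ioi 0)).prod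
          (volume.restrict (Set.Ioo (-Real.pi) Real.pi))), 0 < p.1 := by
        rw [Measure.prod_restrict]
        filter_upwards [ae_restrict_mem (measurableSet_Ioi.prod measurableSet_Ioo)] with p hp
        exact hp.1
      filter_upwards [hfst] with p hp
      have hn : ‖Complex.polarCoord.symm p‖ = p.1 := by
        rw [Complex.norm_polarCoord_symm, abs_of_pos hp]
      simp only [g, Set.indicator, Set.mem_ofPred_eq, Set.mem_Ici, hn, mul_one]
      split_ifs
      · rw [stdDensity, hn, smul_eq_mul, ENNReal.ofReal_mul hp.le]
      · simp
    rw [e1, lintegral_prod_mul hg.aemeasurable aemeasurable_const, lintegral_one,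
      Measure.restrict_apply_univ, Real.volume_Ioo]
    have e2 : ∫⁻ r in Set.Ioi (0:ℝ), g r
        = ∫⁻ r in Set.Ioi t, ENNReal.ofReal (r * (Real.exp (-r ^ 2) / Real.pi)) := by
      simp only [g]
      rw [setLIntegral_indicator measurableSet_Ici]
      refine setLIntegral_congr ?_
      rcases ht.eq_or_lt with h | h
      · rw [← h, Set.inter_eq_right.2 Set.Ioi_subset_Ici_self]
        exact Filter.EventuallyEq.rfl
      · have hs : Set.Ici t ∩ Set.Ioi 0 = Set.Ici t :=
          Set.inter_eq_left.2 fun x hx => h.trans_le (Set.mem_Ici.1 hx)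
        rw [hs]
        exact Ioi_ae_eq_Ici.symm
    have e3 : ∀ r : ℝ, r * (Real.exp (-r ^ 2) / Real.pi)
        = (2 * Real.pi)⁻¹ * (2 * r * Real.exp (-r ^ 2)) := by
      intro r; field_simp
    simp only [e2, e3]
    rw [← ofReal_integral_eq_lintegral_ofReal (hI.1.const_mul _), integral_const_mul, hI.2,
      ← ENNReal.ofReal_mul (by positivity)]
    · congr 1; field_simp; ring
    · filter_upwards [ae_restrict_mem measurableSet_Ioi] with r hr
      have : 0 < r := ht.trans_lt hr
      simp only [Pi.zero_apply]
      positivity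
  rw [key, ENNReal.toReal_ofReal (Real.exp_pos _).le]

/-! ### Unitary invariance of the noise -/

open scoped RealInnerProductSpace in
theorem charFun_stdComplexNormal (w : ℂ) :
    charFun stdComplexNormal w = Complex.exp (-(‖w‖ : ℂ) ^ 2 / 4) := by
  rw [charFun_apply, stdComplexNormal,
    integral_map measurable_re_add_im_I.aemeasurable (by fun_prop)]
  have h : ∀ v : ℝ × ℝ, Complex.exp (⟪(v.1 : ℂ) + (v.2 : ℂ) * Complex.I, w⟫ * Complex.I)
      = Complex.exp (w.re * v.1 * Complex.I) * Complex.exp (w.im * v.2 * Complex.I) := by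
    intro v
    rw [← Complex.exp_add]
    congr 1
    simp [Complex.inner]
    ring
  simp only [h]
  have e1 := charFun_gaussianReal (μ := 0) (v := 1 / 2) w.re
  have e2 := charFun_gaussianReal (μ := 0) (v := 1 / 2) w.im
  rw [charFun_apply_real] at e1 e2
  rw [integral_prod_mul (fun x : ℝ => Complex.exp (w.re * x * Complex.I))
    (fun y : ℝ => Complex.exp (w.im * y * Complex.I)), e1, e2, ← Complex.exp_add]
  congr 1
  have hw : (‖w‖ : ℂ) ^ 2 = (w.re : ℂ) ^ 2 + (w.im : ℂ) ^ 2 := by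
    rw [← Complex.ofReal_pow, Complex.sq_norm, Complex.normSq_apply]
    push_cast
    ring
  rw [hw]
  push_cast
  ring

/-- The law of a standard complex normal vector is invariant under unitary maps. -/
theorem noiseLaw_map_mulVec {N : ℕ} {U : Matrix (Fin N) (Fin N) ℂ}
    (hU : U.conjTranspose * U = 1) :
    (noiseLaw N).map (fun z => U.mulVec z) = noiseLaw N := by
  have hm : Measurable (fun z : Fin N → ℂ => U.mulVec z) := by
    unfold Matrix.mulVec dotProduct
    fun_prop
  have : IsProbabilityMeasure ((noiseLaw N).map (fun z => U.mulVec z)) :=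
    Measure.isProbabilityMeasure_map hm.aemeasurable
  have hU' : U * U.conjTranspose = 1 := mul_eq_one_comm.1 hU
  have hcf : ∀ t : PiLp 2 (fun _ : Fin N => ℂ),
      charFun ((noiseLaw N).map (WithLp.toLp 2)) t = Complex.exp (-((‖t‖ : ℝ) : ℂ) ^ 2 / 4) := by
    intro t
    rw [noiseLaw, charFun_pi]
    simp only [charFun_stdComplexNormal]
    rw [← Complex.exp_sum, ← Complex.ofReal_pow, PiLp.norm_sq_eq_of_L2]
    congr 1
    push_cast
    rw [← Finset.sum_div, Finset.sum_neg_distrib]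
  -- By `hcf` the characteristic function of the noise depends only on the norm of its argument.
  -- Applying `U` to the noise moves the argument to `Uᴴ t`, which has the same norm.
  refine charFun_eq_pi_iff.1 fun t => ?_
  have h1 : ∏ i, charFun stdComplexNormal (t i)
      = charFun ((noiseLaw N).map (WithLp.toLp 2)) t := by
    rw [noiseLaw, charFun_pi]
  set t' : PiLp 2 (fun _ : Fin N => ℂ) :=
    WithLp.toLp 2 (U.conjTranspose.mulVec (WithLp.ofLp t))
  have hnorm : ‖t'‖ = ‖t‖ := by
    have hsq : ∀ x : Fin N → ℂ, (((‖(WithLp.toLp 2 x : PiLp 2 (fun _ : Fin N => ℂ))‖ ^ 2 : ℝ)) : ℂ)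
        = star x ⬝ᵥ x := by
      intro x
      rw [PiLp.norm_sq_eq_of_L2]
      simp only [dotProduct, Pi.star_apply, RCLike.star_def]
      push_cast
      refine Finset.sum_congr rfl fun i _ => ?_
      rw [Complex.conj_mul']
    have : ((‖t'‖ ^ 2 : ℝ) : ℂ) = ((‖t‖ ^ 2 : ℝ) : ℂ) := by
      rw [show t = WithLp.toLp 2 (WithLp.ofLp t) from rfl, hsq, hsq, Matrix.star_mulVec,
        Matrix.conjTranspose_conjTranspose, ← Matrix.dotProduct_mulVec, Matrix.mulVec_mulVec, hU',
        Matrix.one_mulVec]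
    exact (pow_left_inj₀ (norm_nonneg _) (norm_nonneg _) two_ne_zero).1 (by exact_mod_cast this)
  have hmt : Measurable (WithLp.toLp 2 : (Fin N → ℂ) → PiLp 2 (fun _ : Fin N => ℂ)) := by fun_prop
  have h2 : charFun (((noiseLaw N).map (fun z => U.mulVec z)).map (WithLp.toLp 2)) t
      = charFun ((noiseLaw N).map (WithLp.toLp 2)) t' := by
    rw [charFun_apply, charFun_apply, integral_map hmt.aemeasurable (by fun_prop),
      integral_map hmt.aemeasurable (by fun_prop), integral_map hm.aemeasurable (by fun_prop)]
    refine integral_congr_ae (ae_of_all _ fun z => ?_)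
    have hin : ∀ x y : Fin N → ℂ, (inner ℝ (WithLp.toLp 2 x : PiLp 2 (fun _ : Fin N => ℂ))
        (WithLp.toLp 2 y) : ℝ) = (star x ⬝ᵥ y).re := by
      intro x y
      rw [PiLp.inner_apply]
      simp [dotProduct, Complex.inner, mul_comm]
    simp only
    rw [show t = WithLp.toLp 2 (WithLp.ofLp t) from rfl, hin, hin, Matrix.star_mulVec,
      ← Matrix.dotProduct_mulVec]
  rw [h2, h1, hcf, hcf, hnorm]

/-! ### Counts of large coordinates: Chernoff bound and variance -/

/-- The tail probability of a shifted standard complex normal variable. -/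
noncomputable def shiftTail (t : ℝ) (b : ℂ) : ℝ :=
  stdComplexNormal.real {z : ℂ | t ≤ ‖b + z‖}

/-- The indicator of the event that `b + z` has modulus at least `t`. -/
noncomputable def hit (t : ℝ) (b z : ℂ) : ℝ :=
  {z : ℂ | t ≤ ‖b + z‖}.indicator 1 z

theorem measurable_hit (t : ℝ) (b : ℂ) : Measurable (hit t b) :=
  measurable_one.indicator (measurableSet_le_norm_add t b)

theorem hit_eq_zero_or_one (t : ℝ) (b z : ℂ) : hit t b z = 0 ∨ hit t b z = 1 :=
  Set.indicator_eq_zero_or_self _ _ _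

theorem integral_hit (t : ℝ) (b : ℂ) : ∫ z, hit t b z ∂stdComplexNormal = shiftTail t b :=
  integral_indicator_one (measurableSet_le_norm_add t b)

theorem shiftTail_zero (t : ℝ) : shiftTail t 0 = tail t := by simp [shiftTail, tail]

theorem norm_hit_le (t : ℝ) (b z : ℂ) : ‖hit t b z‖ ≤ 1 := by
  rcases hit_eq_zero_or_one t b z with h | h <;> simp [h]

theorem integrable_hit (t : ℝ) (b : ℂ) : Integrable (hit t b) stdComplexNormal :=
  .of_bound (measurable_hit t b).aestronglyMeasurable 1 (ae_of_all _ (norm_hit_le t b))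

theorem mgf_hit (t c : ℝ) (b : ℂ) :
    mgf (hit t b) stdComplexNormal c = 1 + (Real.exp c - 1) * shiftTail t b := by
  have h : ∀ z, Real.exp (c * hit t b z) = 1 + (Real.exp c - 1) * hit t b z := by
    intro z
    rcases hit_eq_zero_or_one t b z with h | h <;> simp [h]
  rw [mgf]
  simp only [h]
  rw [integral_add (integrable_const _) ((integrable_hit t b).const_mul _), integral_const_mul,
    integral_hit]
  simp

theorem variance_hit_le (t : ℝ) (b : ℂ) :
    variance (hit t b) stdComplexNormal ≤ shiftTail t b := by
  refine (variance_le_expectation_sq (measurable_hit t b).aestronglyMeasurable).trans_eq ?_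
  rw [← integral_hit]
  refine integral_congr_ae (ae_of_all _ fun z => ?_)
  rcases hit_eq_zero_or_one t b z with h | h <;> simp [h]

theorem measurePreserving_eval_noiseLaw {N : ℕ} (k : Fin N) :
    MeasurePreserving (Function.eval k) (noiseLaw N) stdComplexNormal :=
  measurePreserving_eval _ k

theorem integral_comp_eval_noiseLaw {N : ℕ} (k : Fin N) {g : ℂ → ℝ} (hg : Measurable g) :
    ∫ z, g (z k) ∂noiseLaw N = ∫ w, g w ∂stdComplexNormal := by
  rw [← (measurePreserving_eval_noiseLaw k).map_eq,
    integral_map (measurable_pi_apply k).aemeasurable hg.aestronglyMeasurable]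

theorem iIndepFun_hit {N : ℕ} (t : ℝ) (b : Fin N → ℂ) :
    iIndepFun (fun k (z : Fin N → ℂ) => hit t (b k) (z k)) (noiseLaw N) :=
  iIndepFun_pi fun k => (measurable_hit t (b k)).aemeasurable

theorem measurable_hit_eval {N : ℕ} (t : ℝ) (b : ℂ) (k : Fin N) :
    Measurable (fun z : Fin N → ℂ => hit t b (z k)) :=
  (measurable_hit t b).comp (measurable_pi_apply k)

/-- A Chernoff bound for the number of large coordinates of the noise. -/
theorem noiseLaw_real_sum_hit_ge_le {N : ℕ} {t m : ℝ} (x : ℝ) (hm : 1 ≤ m) (hN : N * tail t ≤ m) :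
    (noiseLaw N).real {z | m + x * √m ≤ ∑ k, hit t 0 (z k)} ≤ Real.exp (1 - x) := by
  have hs : 1 ≤ √m := Real.one_le_sqrt.2 hm
  -- With this choice `c ≤ 1` and `m c² = 1`, so the quadratic remainder of `exp c` costs at most
  -- `1` in the exponent while the deviation `x √m` contributes exactly `-x`.
  set c := (√m)⁻¹
  have hc0 : 0 < c := by positivity
  have hc1 : c ≤ 1 := inv_le_one_of_one_le₀ hs
  have hms : m * c = √m := by
    rw [← div_eq_mul_inv, Real.div_sqrt]
  have hcs : c * √m = 1 := inv_mul_cancel₀ (by positivity)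
  have hint : Integrable (fun z : Fin N → ℂ => Real.exp (c * ∑ k, hit t 0 (z k))) (noiseLaw N) := by
    refine .of_bound (C := Real.exp (c * N)) ?_ (ae_of_all _ fun z => ?_)
    · exact (Real.measurable_exp.comp ((Finset.measurable_sum _ fun k _ =>
        measurable_hit_eval t 0 k).const_mul c)).aestronglyMeasurable
    · rw [Real.norm_of_nonneg (Real.exp_pos _).le]
      gcongr
      calc ∑ k, hit t 0 (z k) ≤ ∑ _k : Fin N, (1 : ℝ) :=
            Finset.sum_le_sum fun k _ => (le_abs_self _).trans (norm_hit_le _ _ _)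
        _ = N := by simp
  have hmgf : mgf (fun z : Fin N → ℂ => ∑ k, hit t 0 (z k)) (noiseLaw N) c
      ≤ Real.exp (m * (Real.exp c - 1)) := by
    have h1 := (iIndepFun_hit t (0 : Fin N → ℂ)).mgf_sum (t := c)
      (fun k => measurable_hit_eval t 0 k) Finset.univ
    have h2 : (∑ k, fun z : Fin N → ℂ => hit t ((0 : Fin N → ℂ) k) (z k))
        = fun z => ∑ k, hit t 0 (z k) := by
      ext z; simp
    rw [h2] at h1
    have h3 : ∀ k : Fin N, mgf (fun z : Fin N → ℂ => hit t ((0 : Fin N → ℂ) k) (z k)) (noiseLaw N) c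
        = 1 + (Real.exp c - 1) * tail t := by
      intro k
      rw [← shiftTail_zero, ← mgf_hit]
      exact integral_comp_eval_noiseLaw k
        (Real.measurable_exp.comp ((measurable_hit t 0).const_mul c))
    rw [h1, Finset.prod_congr rfl fun k _ => h3 k, Finset.prod_const, Finset.card_univ,
      Fintype.card_fin]
    have hc2 : 0 ≤ Real.exp c - 1 := by linarith [Real.add_one_le_exp c]
    have ht0 : 0 ≤ tail t := measureReal_nonneg
    calc (1 + (Real.exp c - 1) * tail t) ^ N
        ≤ Real.exp ((Real.exp c - 1) * tail t) ^ N := by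
          gcongr
          linarith [Real.add_one_le_exp ((Real.exp c - 1) * tail t)]
      _ = Real.exp ((Real.exp c - 1) * (N * tail t)) := by
          rw [← Real.exp_nat_mul]; congr 1; ring
      _ ≤ Real.exp ((Real.exp c - 1) * m) := by gcongr
      _ = _ := by rw [mul_comm]
  refine (measure_ge_le_exp_mul_mgf _ hc0.le hint).trans ?_
  have hquad : Real.exp c - 1 - c ≤ c ^ 2 :=
    (le_abs_self _).trans (Real.abs_exp_sub_one_sub_id_le (by rwa [abs_of_pos hc0]))
  calc Real.exp (-c * (m + x * √m)) * mgf (fun z : Fin N → ℂ => ∑ k, hit t 0 (z k)) (noiseLaw N) c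
      ≤ Real.exp (-c * (m + x * √m)) * Real.exp (m * (Real.exp c - 1)) := by gcongr
    _ = Real.exp (m * (Real.exp c - 1 - c) - x * (c * √m)) := by
        rw [← Real.exp_add]; congr 1; ring
    _ ≤ Real.exp (1 - x) := by
        rw [hcs, mul_one]
        have : m * (Real.exp c - 1 - c) ≤ m * c ^ 2 := by gcongr
        have h4 : m * c ^ 2 = 1 := by rw [pow_two, ← mul_assoc, hms, mul_comm, hcs]
        gcongr
        linarith

theorem memLp_hit_eval {N : ℕ} (t : ℝ) (b : ℂ) (k : Fin N) (p : ENNReal) :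
    MemLp (fun z : Fin N → ℂ => hit t b (z k)) p (noiseLaw N) :=
  MemLp.of_bound (measurable_hit_eval t b k).aestronglyMeasurable 1
    (ae_of_all _ fun z => norm_hit_le t b (z k))

theorem integral_hit_eval {N : ℕ} (t : ℝ) (b : ℂ) (k : Fin N) :
    ∫ z, hit t b (z k) ∂noiseLaw N = shiftTail t b := by
  rw [← integral_hit, integral_comp_eval_noiseLaw k (measurable_hit t b)]

/-- The variance of the number of large coordinates is at most its expectation. -/
theorem integral_sq_sum_hit_sub_le {N : ℕ} (t : ℝ) (b : Fin N → ℂ) :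
    ∫ z, (∑ k, hit t (b k) (z k) - ∑ k, shiftTail t (b k)) ^ 2 ∂noiseLaw N
      ≤ ∑ k, shiftTail t (b k) := by
  have hv := IndepFun.variance_sum (μ := noiseLaw N) (s := Finset.univ)
    (X := fun k z => hit t (b k) (z k))
    (fun k _ => memLp_hit_eval t (b k) k 2) (fun i _ j _ hij => (iIndepFun_hit t b).indepFun hij)
  have hsum : (∑ k, fun z : Fin N → ℂ => hit t (b k) (z k)) = fun z => ∑ k, hit t (b k) (z k) := by
    ext z; simp
  have hE : ∫ z, ∑ k, hit t (b k) (z k) ∂noiseLaw N = ∑ k, shiftTail t (b k) := by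
    rw [integral_finsetSum _ fun k _ => memLp_one_iff_integrable.1 (memLp_hit_eval t (b k) k 1)]
    exact Finset.sum_congr rfl fun k _ => integral_hit_eval t (b k) k
  rw [hsum, variance_eq_integral (Finset.measurable_sum _ fun k _ =>
    measurable_hit_eval t (b k) k).aemeasurable, hE] at hv
  rw [hv]
  refine Finset.sum_le_sum fun k _ => ?_
  refine le_of_eq_of_le ?_ (variance_hit_le t (b k))
  rw [variance_eq_integral (measurable_hit_eval t (b k) k).aemeasurable,
    variance_eq_integral (measurable_hit t (b k)).aemeasurable, integral_hit_eval, integral_hit]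
  exact integral_comp_eval_noiseLaw k (((measurable_hit t (b k)).sub_const _).pow_const 2)

/-! ### Residue classes of frequencies -/

theorem conj_exp_two_pi_div (q k j : ℕ) :
    (starRingEnd ℂ) (Complex.exp (2 * Real.pi * Complex.I * (k : ℂ) * (j : ℂ) / (q : ℂ)))
      = Complex.exp (-(2 * Real.pi * Complex.I * (k : ℂ) * (j : ℂ) / (q : ℂ))) := by
  rw [← Complex.exp_conj]
  congr 1
  simp [Complex.conj_ofNat]
  ring

theorem sum_exp_two_pi_div_eq_zero {N : ℕ} {d : ℤ} (hd : ¬ (N : ℤ) ∣ d) :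
    ∑ k : Fin N, Complex.exp (2 * Real.pi * Complex.I * d / N * ((k : ℕ) : ℂ)) = 0 := by
  rcases Nat.eq_zero_or_pos N with rfl | hN
  · simp
  have hN' : (N : ℂ) ≠ 0 := by exact_mod_cast hN.ne'
  set w := Complex.exp (2 * Real.pi * Complex.I * d / N)
  have hw : w ≠ 1 := by
    intro h
    obtain ⟨n, hn⟩ := Complex.exp_eq_one_iff.1 h
    apply hd
    refine ⟨n, ?_⟩
    have h2 : (2 * Real.pi * Complex.I : ℂ) ≠ 0 := Complex.two_pi_I_ne_zero
    have h3 : (d : ℂ) = N * n := by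
      field_simp at hn
      linear_combination hn
    exact_mod_cast h3
  have hwN : w ^ N = 1 := by
    rw [← Complex.exp_nat_mul, Complex.exp_eq_one_iff]
    exact ⟨d, by field_simp⟩
  have h : ∀ k : Fin N, Complex.exp (2 * Real.pi * Complex.I * d / N * ((k : ℕ) : ℂ))
      = w ^ (k : ℕ) := fun k => by rw [← Complex.exp_nat_mul, mul_comm]
  rw [Finset.sum_congr rfl fun k _ => h k, Fin.sum_univ_eq_sum_range (fun i => w ^ i),
    geom_sum_eq hw, hwN, sub_self, zero_div]

/-- The frequencies in one residue class modulo `L`. -/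
noncomputable def classMatrix (N L : ℕ) (a : Fin L) : Matrix (Fin N) (Fin N) ℂ :=
  fun k j => oversampling (N * L) N (finProdFinEquiv (k, a)) j

/-- The index of `(k, a)` is `a + L k`, so the phase splits as `k j / N + a j / (N L)`. The matrix
is therefore the unitary discrete Fourier matrix of size `N` times a diagonal matrix of phases. -/
theorem conjTranspose_classMatrix_mul_self {N L : ℕ} (a : Fin L) :
    (classMatrix N L a).conjTranspose * classMatrix N L a = 1 := by
  ext j j'
  have hN : (N : ℂ) ≠ 0 := by exact_mod_cast j.pos.ne'
  have hL : (L : ℂ) ≠ 0 := by exact_mod_cast a.pos.ne'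
  have hsq : (((1 / √(N : ℝ) : ℝ)) : ℂ) * ((1 / √(N : ℝ) : ℝ) : ℂ) = 1 / N := by
    rw [← Complex.ofReal_mul, div_mul_div_comm, one_mul, Real.mul_self_sqrt (Nat.cast_nonneg N)]
    push_cast; rfl
  have hterm : ∀ k : Fin N, star (classMatrix N L a k j) * classMatrix N L a k j'
      = 1 / N * (Complex.exp (2 * Real.pi * Complex.I * (a : ℕ) *
          (((j' : ℕ) : ℂ) - ((j : ℕ) : ℂ)) / (N * L)) *
        Complex.exp (2 * Real.pi * Complex.I * (((j' : ℕ) : ℤ) - ((j : ℕ) : ℤ) : ℤ) / N *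
          ((k : ℕ) : ℂ))) := by
    intro k
    simp only [classMatrix, oversampling, RCLike.star_def, map_mul, Complex.conj_ofReal,
      conj_exp_two_pi_div]
    rw [mul_mul_mul_comm, hsq, ← Complex.exp_add, ← Complex.exp_add]
    congr 2
    simp only [finProdFinEquiv_apply_val]
    push_cast
    field_simp
    ring
  rw [Matrix.mul_apply]
  simp only [Matrix.conjTranspose_apply, hterm]
  rw [← Finset.mul_sum, ← Finset.mul_sum]
  by_cases hjj : j = j'
  · subst hjj
    simp [hN]
  · rw [sum_exp_two_pi_div_eq_zero, Matrix.one_apply_ne hjj]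
    · simp
    · intro hdvd
      apply hjj
      have h1 := Int.eq_zero_of_abs_lt_dvd hdvd (by
        rw [abs_lt]
        have := j.2; have := j'.2
        constructor <;> omega)
      ext
      omega

theorem classMatrix_mulVec {N L : ℕ} (a : Fin L) (k : Fin N) (z : Fin N → ℂ) :
    (classMatrix N L a).mulVec z k
      = (oversampling (N * L) N).mulVec z (finProdFinEquiv (k, a)) := rfl

theorem measurable_mulVec {m n : ℕ} (A : Matrix (Fin m) (Fin n) ℂ) :
    Measurable (fun z : Fin n → ℂ => A.mulVec z) := by
  unfold Matrix.mulVec dotProduct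
  fun_prop

/-- Within a residue class, the transformed noise is again standard. -/
theorem measurePreserving_classMatrix {N L : ℕ} (a : Fin L) :
    MeasurePreserving (fun z => (classMatrix N L a).mulVec z) (noiseLaw N) (noiseLaw N) :=
  ⟨measurable_mulVec _, noiseLaw_map_mulVec (conjTranspose_classMatrix_mul_self a)⟩

/-! ### The error under the null hypothesis -/

theorem exceedances_add (q N : ℕ) (x z : Fin N → ℂ) (t : ℝ) :
    (exceedances q N (x + z) t : ℝ)
      = ∑ m, hit t ((oversampling q N).mulVec x m) ((oversampling q N).mulVec z m) := by
  classical
  rw [exceedances, Set.ncard_eq_toFinset_card', Finset.cast_card, Set.toFinset_ofPred,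
    Finset.sum_filter]
  refine Finset.sum_congr rfl fun m _ => ?_
  rw [periodogram, Real.sqrt_sq (norm_nonneg _), Matrix.mulVec_add, Pi.add_apply, hit,
    Set.indicator_apply]
  simp

theorem sum_fin_mul {N L : ℕ} (f : Fin (N * L) → ℝ) :
    ∑ m, f m = ∑ a : Fin L, ∑ k : Fin N, f (finProdFinEquiv (k, a)) := by
  rw [← finProdFinEquiv.sum_comp, Fintype.sum_prod_type_right]

theorem obsLaw_zero (N p : ℕ) : obsLaw N p 0 = noiseLaw N := by
  simp [obsLaw]

theorem hit_antitone {t t' : ℝ} (h : t' ≤ t) (b z : ℂ) : hit t b z ≤ hit t' b z :=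
  Set.indicator_le_indicator_of_subset (fun _ hz => h.trans hz) (fun _ => zero_le_one) z

/-- If `HC` is large at some level, then some residue class has too many exceedances of some level
of a finite grid. -/
theorem exists_class_of_lt_HC {N L : ℕ} {T t : ℝ} (hT : 0 ≤ T) {z : Fin N → ℂ}
    (ht1 : 1 ≤ t) (ht2 : t ≤ √(Real.log ((N : ℝ) / 3))) (hHC : T < HC (N * L) N z t) :
    ∃ a : Fin L, ∃ j : Fin N,
      ((j : ℕ) + 1 : ℝ) + (T / (4 * √L) - 1) * √((j : ℕ) + 1 : ℝ) ≤
        ∑ k, hit (√(Real.log ((N : ℝ) / ((j : ℕ) + 1 : ℝ)))) 0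
          ((classMatrix N L a).mulVec z k) := by
  have ht0 : 0 ≤ t := zero_le_one.trans ht1
  have hlog : t ^ 2 ≤ Real.log ((N : ℝ) / 3) := (Real.le_sqrt' (by linarith)).1 ht2
  have hlogpos : 0 < Real.log ((N : ℝ) / 3) := by nlinarith
  have hNpos : (0 : ℝ) < N := by
    rcases Nat.eq_zero_or_pos N with rfl | h
    · simp at hlogpos
    · exact_mod_cast h
  have htail := tail_eq ht0
  set Ψ := tail t
  have hΨ0 : 0 < Ψ := htail ▸ Real.exp_pos _
  -- Here `t ≥ 1` enters, through `exp (-1) < 1 / 2`. It gives `√(1 - Ψ) ≥ 1 / 2`, which removes the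
  -- factor `1 - Ψ` from the normalisation.
  have hΨ1 : Ψ ≤ 1 / 2 := by
    rw [htail]
    have h1 : Real.exp (-t ^ 2) ≤ Real.exp (-1) := by gcongr; nlinarith
    have h2 := Real.exp_neg_one_lt_d9
    linarith
  set u := N * Ψ
  have hu3 : 3 ≤ u := by
    have h1 : Real.exp (-Real.log ((N : ℝ) / 3)) ≤ Ψ := by rw [htail]; gcongr
    rw [Real.exp_neg, Real.exp_log (by positivity), inv_div, div_le_iff₀ hNpos] at h1
    linarith
  -- For `L = 0` the quotient defining `HC` has denominator `0`, hence value `0`, which is not above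
  -- `T ≥ 0`.
  have hLpos : (0 : ℝ) < L := by
    rcases Nat.eq_zero_or_pos L with rfl | h
    · simp [HC] at hHC
      linarith
    · exact_mod_cast h
  have hsL : 0 < √(L : ℝ) := Real.sqrt_pos.2 hLpos
  have hHC' : T * (√L * √u * (1 / 2)) < exceedances (N * L) N z t - L * u := by
    have hq : (((N * L : ℕ) : ℝ)) * Ψ = L * u := by push_cast; ring
    rw [HC, hq, Real.sqrt_mul (by positivity), Real.sqrt_mul hLpos.le,
      lt_div_iff₀ (by
        have : 0 < 1 - Ψ := by linarith
        positivity)] at hHC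
    refine lt_of_le_of_lt ?_ hHC
    gcongr
    exact Real.le_sqrt_of_sq_le (by linarith)
  have hC : (exceedances (N * L) N z t : ℝ)
      = ∑ a : Fin L, ∑ k, hit t 0 ((classMatrix N L a).mulVec z k) := by
    have := exceedances_add (N * L) N 0 z t
    rw [zero_add] at this
    rw [this, sum_fin_mul]
    simp [classMatrix_mulVec]
  -- Pigeonhole over the `L` classes: the total excess `T √(L u) / 2` leaves at least `T √u / (2
  -- √L)` in one of them.
  obtain ⟨a, ha⟩ : ∃ a : Fin L, u + T / (2 * √L) * √u
      < ∑ k, hit t 0 ((classMatrix N L a).mulVec z k) := by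
    by_contra! hcon
    have h1 := Finset.sum_le_sum fun a (_ : a ∈ (Finset.univ : Finset (Fin L))) => hcon a
    rw [← hC, Finset.sum_const, Finset.card_univ, Fintype.card_fin, nsmul_eq_mul] at h1
    have h2 : (L : ℝ) * (u + T / (2 * √L) * √u) = L * u + T * (√L * √u * (1 / 2)) := by
      have : (L : ℝ) = √L * √L := (Real.mul_self_sqrt hLpos.le).symm
      field_simp
      linear_combination (T * √u) * this
    linarith
  have hfl : (⌊u⌋₊ : ℝ) ≤ u := Nat.floor_le (by linarith)
  have hfl' : u < ⌊u⌋₊ + 1 := Nat.lt_floor_add_one u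
  have hjN : ⌊u⌋₊ < N := by
    have : (⌊u⌋₊ : ℝ) < N := by
      have : u ≤ N * (1 / 2) := by simp only [u]; gcongr
      linarith
    exact_mod_cast this
  -- The grid level has expected count `⌊u⌋ + 1`, just above `u`, so it lies below `t` and catches
  -- every exceedance of `t`. The increase of the mean by at most `1 ≤ √(j + 1)` is paid for by the
  -- `-1` in the coefficient; `√(j + 1) ≤ 2 √u` turns the `2` in the denominator into `4`.
  refine ⟨a, ⟨⌊u⌋₊, hjN⟩, ?_⟩
  simp only
  set j : ℝ := (⌊u⌋₊ : ℝ)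
  have hlevel : √(Real.log ((N : ℝ) / (j + 1))) ≤ t := by
    rw [Real.sqrt_le_left ht0]
    have h1 : (N : ℝ) / (j + 1) ≤ Real.exp (t ^ 2) := by
      rw [div_le_iff₀ (by positivity)]
      have h2 : (N : ℝ) = Real.exp (t ^ 2) * u := by
        simp only [u]
        rw [htail, Real.exp_neg]
        field_simp
      calc (N : ℝ) = Real.exp (t ^ 2) * u := h2
        _ ≤ _ := by gcongr
    calc Real.log ((N : ℝ) / (j + 1)) ≤ Real.log (Real.exp (t ^ 2)) := by gcongr
      _ = t ^ 2 := Real.log_exp _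
  have hmono : ∑ k, hit t 0 ((classMatrix N L a).mulVec z k)
      ≤ ∑ k, hit (√(Real.log ((N : ℝ) / (j + 1)))) 0 ((classMatrix N L a).mulVec z k) :=
    Finset.sum_le_sum fun k _ => hit_antitone hlevel _ _
  have hs1 : 1 ≤ √(j + 1) := Real.one_le_sqrt.2 (le_add_of_nonneg_left (Nat.cast_nonneg _))
  have hs2 : √(j + 1) ≤ 2 * √u := by
    rw [Real.sqrt_le_left (by positivity), mul_pow, Real.sq_sqrt (by linarith)]
    linarith
  have hstep : T / (4 * √L) * √(j + 1) ≤ T / (2 * √L) * √u := by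
    calc T / (4 * √L) * √(j + 1) ≤ T / (4 * √L) * (2 * √u) := by gcongr
      _ = _ := by field_simp; ring
  linarith

/-- The level of the test. -/
theorem obsLaw_zero_rejectionRegion_le {N L p : ℕ} {T : ℝ} (hT : 0 ≤ T) :
    obsLaw N p 0 (rejectionRegion (N * L) N 1 (√(Real.log ((N : ℝ) / 3))) T)
      ≤ ENNReal.ofReal (L * N * Real.exp (2 - T / (4 * √L))) := by
  rw [obsLaw_zero]
  set x := T / (4 * √L) - 1
  let E : Fin L → Fin N → Set (Fin N → ℂ) := fun a j =>
    (fun z => (classMatrix N L a).mulVec z) ⁻¹'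
      {z | ((j : ℕ) + 1 : ℝ) + x * √((j : ℕ) + 1 : ℝ) ≤
        ∑ k, hit (√(Real.log ((N : ℝ) / ((j : ℕ) + 1 : ℝ)))) 0 (z k)}
  -- The uncountable supremum over `t` is covered by `L N` measurable events, so monotonicity of the
  -- measure suffices and measurability of the rejection region itself plays no role.
  have hsub : rejectionRegion (N * L) N 1 (√(Real.log ((N : ℝ) / 3))) T ⊆ ⋃ a, ⋃ j, E a j := by
    intro z hz
    simp only [rejectionRegion, HCstar, Set.mem_ofPred_eq, lt_iSup_iff, EReal.coe_lt_coe_iff] at hz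
    obtain ⟨t, ht, hHC⟩ := hz
    obtain ⟨a, j, haj⟩ := exists_class_of_lt_HC hT ht.1 ht.2 hHC
    exact Set.mem_iUnion.2 ⟨a, Set.mem_iUnion.2 ⟨j, haj⟩⟩
  have hE : ∀ a j, noiseLaw N (E a j) ≤ ENNReal.ofReal (Real.exp (1 - x)) := by
    intro a j
    have hm : MeasurableSet {z : Fin N → ℂ | ((j : ℕ) + 1 : ℝ) + x * √((j : ℕ) + 1 : ℝ) ≤
        ∑ k, hit (√(Real.log ((N : ℝ) / ((j : ℕ) + 1 : ℝ)))) 0 (z k)} :=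
      measurableSet_le measurable_const
        (Finset.measurable_sum _ fun k _ => measurable_hit_eval _ 0 k)
    rw [(measurePreserving_classMatrix a).measure_preimage hm.nullMeasurableSet,
      ← ofReal_measureReal]
    apply ENNReal.ofReal_le_ofReal
    refine noiseLaw_real_sum_hit_ge_le x (by simp) ?_
    have hN : (0 : ℝ) < N := by exact_mod_cast j.pos
    have hj : ((j : ℕ) + 1 : ℝ) ≤ N := by exact_mod_cast j.2
    have hlog : 0 ≤ Real.log ((N : ℝ) / ((j : ℕ) + 1 : ℝ)) :=
      Real.log_nonneg ((one_le_div (by positivity)).2 hj)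
    rw [tail_eq (Real.sqrt_nonneg _), Real.sq_sqrt hlog, Real.exp_neg,
      Real.exp_log (by positivity), inv_div, mul_div_cancel₀ _ hN.ne']
  calc noiseLaw N (rejectionRegion (N * L) N 1 (√(Real.log ((N : ℝ) / 3))) T)
      ≤ noiseLaw N (⋃ a, ⋃ j, E a j) := measure_mono hsub
    _ ≤ ∑ a, ∑ j, noiseLaw N (E a j) :=
        (measure_iUnion_fintype_le _ _).trans
          (Finset.sum_le_sum fun a _ => measure_iUnion_fintype_le _ _)
    _ ≤ ∑ _a : Fin L, ∑ _j : Fin N, ENNReal.ofReal (Real.exp (1 - x)) :=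
        Finset.sum_le_sum fun a _ => Finset.sum_le_sum fun j _ => hE a j
    _ = ENNReal.ofReal (L * N * Real.exp (2 - T / (4 * √L))) := by
        have hx : 1 - x = 2 - T / (4 * √L) := by simp only [x]; ring
        simp only [Finset.sum_const, Finset.card_univ, Fintype.card_fin, nsmul_eq_mul, hx]
        rw [ENNReal.ofReal_mul (by positivity), ENNReal.ofReal_mul (by positivity),
          ENNReal.ofReal_natCast, ENNReal.ofReal_natCast, mul_assoc]

/-! ### The error under an alternative: Chebyshev's inequality -/

theorem measurable_hit_mulVec {m n : ℕ} (A : Matrix (Fin m) (Fin n) ℂ) (t : ℝ) (b : ℂ) (k : Fin m) :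
    Measurable (fun z : Fin n → ℂ => hit t b (A.mulVec z k)) :=
  (measurable_hit_eval t b k).comp (measurable_mulVec A)

/-- The variance of the number of exceedances is at most `L` times its expectation. -/
theorem integral_sq_sum_hit_oversampling_sub_le {N L : ℕ} (t : ℝ) (b : Fin (N * L) → ℂ) :
    ∫ z, (∑ m, hit t (b m) ((oversampling (N * L) N).mulVec z m) - ∑ m, shiftTail t (b m)) ^ 2
      ∂noiseLaw N ≤ L * ∑ m, shiftTail t (b m) := by
  let F : Fin L → (Fin N → ℂ) → ℝ := fun a z =>
    (∑ k, hit t (b (finProdFinEquiv (k, a))) (z k) - ∑ k, shiftTail t (b (finProdFinEquiv (k, a)))) ^ 2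
  have hFm : ∀ a, Measurable (F a) := fun a =>
    ((Finset.measurable_sum _ fun k _ => measurable_hit_eval _ _ k).sub_const _).pow_const 2
  have hFb : ∀ a, Integrable (fun z => F a ((classMatrix N L a).mulVec z)) (noiseLaw N) := by
    intro a
    refine ((measurePreserving_classMatrix a).integrable_comp (hFm a).aestronglyMeasurable).2 ?_
    have hs : MemLp (fun z : Fin N → ℂ => ∑ k, hit t (b (finProdFinEquiv (k, a))) (z k)) 2
        (noiseLaw N) :=
      memLp_finsetSum _ fun k _ => memLp_hit_eval t (b (finProdFinEquiv (k, a))) k 2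
    exact (hs.sub (memLp_const (∑ k, shiftTail t (b (finProdFinEquiv (k, a)))))).integrable_sq
  have hFi : ∀ a, ∫ z, F a ((classMatrix N L a).mulVec z) ∂noiseLaw N
      ≤ ∑ k, shiftTail t (b (finProdFinEquiv (k, a))) := by
    intro a
    have h := integral_map (measurePreserving_classMatrix (N := N) a).measurable.aemeasurable
      (hFm a).aestronglyMeasurable (μ := noiseLaw N)
    rw [(measurePreserving_classMatrix a).map_eq] at h
    rw [← h]
    exact integral_sq_sum_hit_sub_le t _
  -- Cauchy–Schwarz over the classes replaces any knowledge of their joint law, at the price of the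
  -- factor `L`.
  have hpt : ∀ z, (∑ m, hit t (b m) ((oversampling (N * L) N).mulVec z m)
      - ∑ m, shiftTail t (b m)) ^ 2 ≤ L * ∑ a, F a ((classMatrix N L a).mulVec z) := by
    intro z
    rw [sum_fin_mul, sum_fin_mul, ← Finset.sum_sub_distrib]
    refine (sq_sum_le_card_mul_sum_sq).trans_eq ?_
    simp [F, classMatrix_mulVec]
  calc _ ≤ ∫ z, L * ∑ a, F a ((classMatrix N L a).mulVec z) ∂noiseLaw N := by
        refine integral_mono_of_nonneg (ae_of_all _ fun z => sq_nonneg _)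
          ((integrable_finsetSum _ fun a _ => hFb a).const_mul _) (ae_of_all _ hpt)
    _ = L * ∑ a, ∫ z, F a ((classMatrix N L a).mulVec z) ∂noiseLaw N := by
        rw [integral_const_mul, integral_finsetSum _ fun a _ => hFb a]
    _ ≤ L * ∑ m, shiftTail t (b m) := by
        rw [sum_fin_mul]
        gcongr with a
        exact hFi a

/-- The mean of the transformed observation. -/
noncomputable def signalMean (q N p : ℕ) (β : Fin p → ℂ) : Fin q → ℂ :=
  (oversampling q N).mulVec ((design N p).mulVec β)

theorem tail_lt_one {t : ℝ} (ht : 0 < t) : tail t < 1 := by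
  rw [tail_eq ht.le, Real.exp_lt_one_iff]
  nlinarith

theorem tail_pos {t : ℝ} (ht : 0 ≤ t) : 0 < tail t := by
  rw [tail_eq ht]; exact Real.exp_pos _

/-- Chebyshev's inequality for the probability of accepting under an alternative. -/
theorem obsLaw_compl_rejectionRegion_le {N L p : ℕ} {β : Fin p → ℂ} {lo hi t T D : ℝ}
    (ht : 0 < t) (hlo : lo ≤ t) (hhi : t ≤ hi) (hT : 0 ≤ T) (hD : 0 < D)
    (hsum : D ≤ ∑ m, (shiftTail t (signalMean (N * L) N p β m) - tail t))
    (hTD : 2 * T * √(N * L * tail t) ≤ D) :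
    obsLaw N p β (rejectionRegion (N * L) N lo hi T)ᶜ
      ≤ ENNReal.ofReal (4 * L * (N * L * tail t / D ^ 2 + 1 / D)) := by
  set Ψ := tail t
  have hΨ0 : 0 < Ψ := tail_pos ht.le
  have hΨ1 : Ψ < 1 := tail_lt_one ht
  set b := signalMean (N * L) N p β
  set U := oversampling (N * L) N
  set M := ∑ m, shiftTail t (b m)
  have hM : ∑ m, (shiftTail t (b m) - Ψ) = M - N * L * Ψ := by
    rw [Finset.sum_sub_distrib]; simp [M]
  rw [hM] at hsum
  set D' := M - N * L * Ψ
  have hD' : 0 < D' := hD.trans_le hsum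
  have hq : (0 : ℝ) < N * L := by
    rcases Nat.eq_zero_or_pos (N * L) with h | h
    · exfalso
      have : IsEmpty (Fin (N * L)) := by rw [h]; infer_instance
      have h0 : (N : ℝ) * L = 0 := by exact_mod_cast h
      simp only [D', M, h0, Finset.univ_eq_empty, Finset.sum_empty] at hD'
      linarith
    · exact_mod_cast h
  let E : Set (Fin N → ℂ) := {y | (exceedances (N * L) N y t : ℝ) ≤ M - D' / 2}
  -- Acceptance bounds `HC` at the one level `t`. By `hTD` the allowed excess is at most `D / 2 ≤ D'
  -- / 2`, so the count falls short of its mean `M` by at least `D' / 2`.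
  have hsub : (rejectionRegion (N * L) N lo hi T)ᶜ ⊆ E := by
    intro y hy
    have hle : HCstar (N * L) N lo hi y ≤ T := not_lt.1 hy
    have h1 : ((HC (N * L) N y t : ℝ) : EReal) ≤ T :=
      (le_iSup₂ (f := fun (t : ℝ) (_ : t ∈ Set.Icc lo hi) => ((HC (N * L) N y t : ℝ) : EReal))
        t ⟨hlo, hhi⟩).trans hle
    have h2 : HC (N * L) N y t ≤ T := EReal.coe_le_coe_iff.1 h1
    have hcast : ((N * L : ℕ) : ℝ) = N * L := by push_cast; rfl
    rw [HC, hcast, div_le_iff₀ (Real.sqrt_pos.2 (mul_pos (mul_pos hq hΨ0) (by linarith)))] at h2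
    have h2' : (exceedances (N * L) N y t : ℝ) - N * L * Ψ ≤ T * √(N * L * Ψ * (1 - Ψ)) := h2
    have h3 : T * √(N * L * Ψ * (1 - Ψ)) ≤ T * √(N * L * Ψ) := by
      refine mul_le_mul_of_nonneg_left (Real.sqrt_le_sqrt ?_) hT
      exact mul_le_of_le_one_right (by positivity) (by linarith)
    simp only [E, Set.mem_ofPred_eq]
    have h4 : M = D' + N * L * Ψ := by simp [D']
    linarith
  have hexc : ∀ z, (exceedances (N * L) N ((design N p).mulVec β + z) t : ℝ)
      = ∑ m, hit t (b m) (U.mulVec z m) := fun z => exceedances_add _ _ _ _ _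
  have hEm : MeasurableSet E := by
    have h : ∀ y, (exceedances (N * L) N y t : ℝ) = ∑ m, hit t 0 (U.mulVec y m) := by
      intro y
      have := exceedances_add (N * L) N 0 y t
      simpa using this
    simp only [E, h]
    exact measurableSet_le (Finset.measurable_sum _ fun m _ => measurable_hit_mulVec U t 0 m)
      measurable_const
  let G : (Fin N → ℂ) → ℝ := fun z => (∑ m, hit t (b m) (U.mulVec z m) - M) ^ 2
  have hG : Integrable G (noiseLaw N) := by
    have hs : MemLp (fun z : Fin N → ℂ => ∑ m, hit t (b m) (U.mulVec z m)) 2 (noiseLaw N) :=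
      memLp_finsetSum _ fun m _ =>
        MemLp.of_bound (measurable_hit_mulVec U t (b m) m).aestronglyMeasurable 1
          (ae_of_all _ fun z => norm_hit_le t (b m) _)
    exact (hs.sub (memLp_const M)).integrable_sq
  have hcheb := mul_meas_ge_le_integral_of_nonneg (ae_of_all _ fun z => sq_nonneg _) hG
    ((D' / 2) ^ 2)
  have hint : ∫ z, G z ∂noiseLaw N ≤ L * M := integral_sq_sum_hit_oversampling_sub_le t b
  have hshift : Measurable (fun z : Fin N → ℂ => (design N p).mulVec β + z) := by fun_prop
  calc obsLaw N p β (rejectionRegion (N * L) N lo hi T)ᶜ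
      ≤ obsLaw N p β E := measure_mono hsub
    _ = noiseLaw N ((fun z => (design N p).mulVec β + z) ⁻¹' E) := by
        rw [obsLaw, Measure.map_apply hshift hEm]
    _ ≤ noiseLaw N {z | (D' / 2) ^ 2 ≤ G z} := by
        refine measure_mono fun z hz => ?_
        simp only [E, Set.mem_preimage, Set.mem_ofPred_eq, hexc] at hz
        simp only [G, Set.mem_ofPred_eq]
        rw [← neg_sq (∑ m, hit t (b m) (U.mulVec z m) - M)]
        gcongr
        linarith
    _ ≤ ENNReal.ofReal (4 * L * (N * L * Ψ / D ^ 2 + 1 / D)) := by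
        rw [← ofReal_measureReal]
        apply ENNReal.ofReal_le_ofReal
        have h1 : (noiseLaw N).real {z | (D' / 2) ^ 2 ≤ G z} ≤ L * M / (D' / 2) ^ 2 := by
          rw [le_div_iff₀ (by positivity), mul_comm]
          exact hcheb.trans hint
        refine h1.trans ?_
        have h4 : M = D' + N * L * Ψ := by simp [D']
        have h5 : L * M / (D' / 2) ^ 2 = 4 * L * (N * L * Ψ / D' ^ 2 + 1 / D') := by
          rw [h4]; field_simp; ring
        rw [h5]
        gcongr

/-! ### The Dirichlet kernel and the mean of the transformed signal -/

/-- The normalized Dirichlet kernel. -/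
noncomputable def dirichletKernel (N : ℕ) (x : ℝ) : ℂ :=
  1 / N * ∑ j : Fin N, Complex.exp (Complex.I * (2 * Real.pi * x * (j : ℕ) : ℝ))

theorem norm_dirichletKernel_sub_one_le {N : ℕ} (hN : 0 < N) (x : ℝ) :
    ‖dirichletKernel N x - 1‖ ≤ 2 * Real.pi * N * |x| := by
  have hN' : (N : ℂ) ≠ 0 := by exact_mod_cast hN.ne'
  have h : dirichletKernel N x - 1
      = 1 / N * ∑ j : Fin N, (Complex.exp (Complex.I * (2 * Real.pi * x * (j : ℕ) : ℝ)) - 1) := by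
    rw [dirichletKernel, Finset.sum_sub_distrib, mul_sub]
    simp [hN']
  rw [h, norm_mul, norm_div, norm_one, Complex.norm_natCast]
  have hb : ‖∑ j : Fin N, (Complex.exp (Complex.I * (2 * Real.pi * x * (j : ℕ) : ℝ)) - 1)‖
      ≤ ∑ _j : Fin N, 2 * Real.pi * N * |x| := by
    refine norm_sum_le_of_le _ fun j _ => ?_
    refine (Real.norm_exp_I_mul_ofReal_sub_one_le).trans ?_
    rw [Real.norm_eq_abs, abs_mul, abs_mul, abs_of_pos Real.two_pi_pos, Nat.abs_cast]
    have hj : ((j : ℕ) : ℝ) ≤ N := by exact_mod_cast j.2.le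
    calc 2 * Real.pi * |x| * (j : ℕ) ≤ 2 * Real.pi * |x| * N := by gcongr
      _ = _ := by ring
  rw [Finset.sum_const, Finset.card_univ, Fintype.card_fin, nsmul_eq_mul] at hb
  have hN'' : (0 : ℝ) < N := by exact_mod_cast hN
  calc 1 / (N : ℝ) * _ ≤ 1 / (N : ℝ) * (N * (2 * Real.pi * N * |x|)) := by gcongr
    _ = _ := by field_simp

/-- Jordan's inequality gives `sin (π w) ≥ 2 w` on `(0, 1/2]`, applied to the distance `w` from
`|x|` to the nearer of `0` and `1`. Adding both reciprocals avoids later case distinctions about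
wrap-around on the circle. -/
theorem one_div_abs_sin_pi_mul_le {x : ℝ} (h0 : 0 < |x|) (h1 : |x| < 1) :
    0 < |Real.sin (Real.pi * x)| ∧
    1 / |Real.sin (Real.pi * x)| ≤ 1 / 2 * (1 / |x| + 1 / (1 - |x|)) := by
  have habs : |Real.sin (Real.pi * x)| = |Real.sin (Real.pi * |x|)| := by
    rcases abs_choice x with h | h <;> rw [h]
    rw [mul_neg, Real.sin_neg, abs_neg]
  rw [habs]
  set y := |x|
  have key : ∀ w : ℝ, 0 < w → w ≤ 1 / 2 → 2 * w ≤ Real.sin (Real.pi * w) := by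
    intro w hw0 hw1
    have := Real.mul_le_sin (x := Real.pi * w) (by positivity) (by nlinarith [Real.pi_pos])
    have e : 2 / Real.pi * (Real.pi * w) = 2 * w := by field_simp
    linarith
  have h1y : 0 < 1 - y := by linarith
  have main : ∀ w : ℝ, 0 < w → 2 * w ≤ |Real.sin (Real.pi * y)| →
      (1 / w ≤ 1 / y + 1 / (1 - y)) → 0 < |Real.sin (Real.pi * y)| ∧
      1 / |Real.sin (Real.pi * y)| ≤ 1 / 2 * (1 / y + 1 / (1 - y)) := by
    intro w hw hws hwy
    refine ⟨by linarith, ?_⟩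
    calc 1 / |Real.sin (Real.pi * y)| ≤ 1 / (2 * w) := by gcongr
      _ = 1 / 2 * (1 / w) := by field_simp
      _ ≤ _ := by gcongr
  rcases le_total y (1 / 2) with hy | hy
  · refine main y h0 ((key y h0 hy).trans (le_abs_self _)) ?_
    have : 0 ≤ 1 / (1 - y) := by positivity
    linarith
  · refine main (1 - y) h1y ?_ ?_
    · have := key (1 - y) h1y (by linarith)
      rw [show Real.pi * (1 - y) = Real.pi - Real.pi * y by ring, Real.sin_pi_sub] at this
      exact this.trans (le_abs_self _)
    · have : 0 ≤ 1 / y := by positivity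
      linarith

theorem norm_dirichletKernel_le {N : ℕ} (hN : 0 < N) {x : ℝ} (h0 : 0 < |x|) (h1 : |x| < 1) :
    ‖dirichletKernel N x‖ ≤ 1 / (2 * N) * (1 / |x| + 1 / (1 - |x|)) := by
  obtain ⟨hs, hs'⟩ := one_div_abs_sin_pi_mul_le h0 h1
  set w := Complex.exp (Complex.I * (2 * Real.pi * x : ℝ))
  have hw : ‖w - 1‖ = 2 * |Real.sin (Real.pi * x)| := by
    rw [Complex.norm_exp_I_mul_ofReal_sub_one, Real.norm_eq_abs, abs_mul, abs_two]
    congr 3; ring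
  have hw1 : w ≠ 1 := by
    intro h
    rw [h, sub_self, norm_zero] at hw
    linarith
  have hwn : ‖w‖ = 1 := Complex.norm_exp_I_mul_ofReal _
  have h : ∀ j : Fin N, Complex.exp (Complex.I * (2 * Real.pi * x * (j : ℕ) : ℝ)) = w ^ (j : ℕ) := by
    intro j
    rw [← Complex.exp_nat_mul]
    congr 1
    push_cast; ring
  rw [dirichletKernel, Finset.sum_congr rfl fun j _ => h j,
    Fin.sum_univ_eq_sum_range (fun i => w ^ i), geom_sum_eq hw1, norm_mul, norm_div, norm_div,
    norm_one, Complex.norm_natCast, hw]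
  have hnum : ‖w ^ N - 1‖ ≤ 2 := by
    refine (norm_sub_le _ _).trans ?_
    rw [norm_pow, hwn, one_pow, norm_one]; norm_num
  have hN'' : (0 : ℝ) < N := by exact_mod_cast hN
  calc 1 / (N : ℝ) * (‖w ^ N - 1‖ / (2 * |Real.sin (Real.pi * x)|))
      ≤ 1 / (N : ℝ) * (2 / (2 * |Real.sin (Real.pi * x)|)) := by gcongr
    _ = 1 / (N : ℝ) * (1 / |Real.sin (Real.pi * x)|) := by field_simp
    _ ≤ 1 / (N : ℝ) * (1 / 2 * (1 / |x| + 1 / (1 - |x|))) := by gcongr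
    _ = _ := by field_simp

/-- The phases of the two Fourier matrices multiply to a function of the frequency difference, and
summing over time produces the kernel. -/
theorem signalMean_sparseVector (q N : ℕ) {p s : ℕ} (τ : Fin s → Fin p) (b : Fin s → ℂ)
    (m : Fin q) :
    signalMean q N p (sparseVector τ b) m
      = ∑ l, b l * (√((N : ℝ) / p) : ℝ) *
          dirichletKernel N (((m : ℕ) : ℝ) / q - ((τ l : ℕ) : ℝ) / p) := by
  have h1 : ∀ j, (design N p).mulVec (sparseVector τ b) j = ∑ l, design N p j (τ l) * b l := by
    intro j
    simp only [Matrix.mulVec, dotProduct, sparseVector, Finset.mul_sum]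
    rw [Finset.sum_comm]
    simp
  rw [signalMean, Matrix.mulVec, dotProduct]
  simp only [h1, Finset.mul_sum]
  rw [Finset.sum_comm]
  refine Finset.sum_congr rfl fun l _ => ?_
  rw [dirichletKernel, Finset.mul_sum, Finset.mul_sum]
  refine Finset.sum_congr rfl fun j _ => ?_
  have hN : (0 : ℝ) < N := by exact_mod_cast j.pos
  have hc : ((√((N : ℝ) / p) : ℝ) : ℂ) * (1 / N)
      = ((1 / √(N : ℝ) : ℝ) : ℂ) * ((1 / √(p : ℝ) : ℝ) : ℂ) := by
    rw [Real.sqrt_div hN.le]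
    have : (N : ℂ) = ((√(N : ℝ) : ℝ) : ℂ) * ((√(N : ℝ) : ℝ) : ℂ) := by
      rw [← Complex.ofReal_mul, Real.mul_self_sqrt hN.le]; push_cast; rfl
    have h0 : ((√(N : ℝ) : ℝ) : ℂ) ≠ 0 := by
      exact_mod_cast (Real.sqrt_pos.2 hN).ne'
    rw [this]
    push_cast
    field_simp
  have he : Complex.exp (Complex.I *
        (2 * Real.pi * (((m : ℕ) : ℝ) / q - ((τ l : ℕ) : ℝ) / p) * (j : ℕ) : ℝ))
      = Complex.exp (2 * Real.pi * Complex.I * ((m : ℕ) : ℂ) * ((j : ℕ) : ℂ) / (q : ℂ)) *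
        Complex.exp (-(2 * Real.pi * Complex.I * ((τ l : ℕ) : ℂ) * ((j : ℕ) : ℂ) / (p : ℂ))) := by
    rw [← Complex.exp_add]
    congr 1
    push_cast; ring
  rw [he]
  simp only [oversampling, design]
  linear_combination (-(b l) * Complex.exp (2 * Real.pi * Complex.I * ((m : ℕ) : ℂ) * ((j : ℕ) : ℂ) / (q : ℂ)) *
        Complex.exp (-(2 * Real.pi * Complex.I * ((τ l : ℕ) : ℂ) * ((j : ℕ) : ℂ) / (p : ℂ)))) * hc

/-! ### Separated frequencies: leakage and total excess -/

theorem sum_one_div_le_one_add_log {ι : Type*} {S : Finset ι} {g : ι → ℕ} {s : ℕ}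
    (hg : Set.InjOn g S) (h1 : ∀ i ∈ S, 1 ≤ g i) (hs : ∀ i ∈ S, g i ≤ s) :
    ∑ i ∈ S, 1 / (g i : ℝ) ≤ 1 + Real.log s := by
  classical
  calc ∑ i ∈ S, 1 / (g i : ℝ) = ∑ d ∈ S.image g, 1 / (d : ℝ) :=
        (Finset.sum_image (f := fun d : ℕ => 1 / (d : ℝ)) hg).symm
    _ ≤ ∑ d ∈ Finset.Icc 1 s, 1 / (d : ℝ) := by
        refine Finset.sum_le_sum_of_subset_of_nonneg ?_ fun _ _ _ => by positivity
        intro d hd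
        obtain ⟨i, hi, rfl⟩ := Finset.mem_image.1 hd
        exact Finset.mem_Icc.2 ⟨h1 i hi, hs i hi⟩
    _ = ((harmonic s : ℚ) : ℝ) := by
        rw [harmonic_eq_sum_Icc]
        push_cast
        simp
    _ ≤ 1 + Real.log s := harmonic_le_one_add_log s

section Separation

variable {p s : ℕ} {τ : Fin s → Fin p} {g δ : ℝ}

theorem le_gap_of_le_separation (hδ : δ ≤ separation τ) (l : Fin s) : p * δ ≤ gap τ l := by
  have hp : (0 : ℝ) < p := by exact_mod_cast (τ l).pos
  have h1 : ⨅ l, gap τ l ≤ gap τ l := ciInf_le (Set.finite_range _).bddBelow l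
  have h2 : p * separation τ = ⨅ l, gap τ l := by
    rw [separation]; field_simp
  calc p * δ ≤ p * separation τ := by gcongr
    _ = _ := h2
    _ ≤ _ := h1

theorem mul_gap_le_sub (hτ : StrictMono τ) (hg : ∀ l, g ≤ gap τ l) {i j : Fin s} (hij : i ≤ j) :
    (((j : ℕ) : ℝ) - ((i : ℕ) : ℝ)) * g ≤ ((τ j : ℕ) : ℝ) - ((τ i : ℕ) : ℝ) := by
  obtain ⟨j, hj⟩ := j
  induction j with
  | zero =>
    have : i = ⟨0, hj⟩ := Fin.ext (Nat.le_zero.1 hij)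
    simp [this]
  | succ k ih =>
    rcases (Fin.le_def.1 hij).eq_or_lt with h | h
    · have : i = ⟨k + 1, hj⟩ := Fin.ext h
      simp [this]
    · have h1 := ih (Nat.lt_of_succ_lt hj) (Fin.le_def.2 (Nat.lt_succ_iff.1 h))
      have h2 := hg ⟨k, Nat.lt_of_succ_lt hj⟩
      have hlt : τ ⟨k, Nat.lt_of_succ_lt hj⟩ < τ ⟨k + 1, hj⟩ := hτ (Fin.lt_def.2 (Nat.lt_succ_self k))
      have hlt' : ((τ ⟨k, Nat.lt_of_succ_lt hj⟩ : ℕ) : ℝ) ≤ ((τ ⟨k + 1, hj⟩ : ℕ) : ℝ) := by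
        exact_mod_cast (Fin.lt_def.1 hlt).le
      rw [gap, dif_pos hj, abs_of_nonneg (sub_nonneg.2 hlt')] at h2
      push_cast at h1 h2 ⊢
      linarith

/-- The way around the circle from `τ_j` to `τ_i` consists of the gaps from `j` to the last index,
the closing gap, and the gaps from the first index to `i`. The closing gap is why `separation`
includes `τ_{s+1}`. -/
theorem mul_gap_le_wrap (hτ : StrictMono τ) (hg : ∀ l, g ≤ gap τ l) (i j : Fin s) :
    ((s : ℝ) - (((j : ℕ) : ℝ) - ((i : ℕ) : ℝ))) * g
      ≤ (p : ℝ) - (((τ j : ℕ) : ℝ) - ((τ i : ℕ) : ℝ)) := by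
  have hs : 0 < s := i.pos
  have h1 := mul_gap_le_sub hτ hg (i := ⟨0, hs⟩) (j := i) (Fin.le_def.2 (Nat.zero_le _))
  have h2 := mul_gap_le_sub hτ hg (i := j) (j := ⟨s - 1, by omega⟩)
    (Fin.le_def.2 (Nat.le_sub_one_of_lt j.2))
  have h3 := hg ⟨s - 1, by omega⟩
  have hlt : ((τ ⟨s - 1, by omega⟩ : ℕ) : ℝ) ≤ p := by
    exact_mod_cast (τ ⟨s - 1, by omega⟩).2.le
  have h0 : (0 : ℝ) ≤ ((τ ⟨0, hs⟩ : ℕ) : ℝ) := Nat.cast_nonneg _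
  rw [gap, dif_neg (by simp only; omega), abs_of_nonneg (by linarith)] at h3
  have hs1 : ((s - 1 : ℕ) : ℝ) = s - 1 := by rw [Nat.cast_sub hs]; simp
  simp only [hs1, Nat.cast_zero] at h1 h2
  linarith

/-- Natural-number division is the floor, so `q * k / p` indexes the grid frequency immediately at
or below `k / p`. -/
theorem abs_sub_natDiv_le {q p k : ℕ} (hq : 0 < q) (hp : 0 < p) :
    0 ≤ (k : ℝ) / p - ((q * k / p : ℕ) : ℝ) / q ∧
      (k : ℝ) / p - ((q * k / p : ℕ) : ℝ) / q ≤ 1 / q := by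
  have hq' : (0 : ℝ) < q := by exact_mod_cast hq
  have hp' : (0 : ℝ) < p := by exact_mod_cast hp
  have h1 : ((q * k / p : ℕ) : ℝ) ≤ (q * k : ℝ) / p := by
    have := Nat.cast_div_le (α := ℝ) (m := q * k) (n := p)
    push_cast at this; exact this
  have h2 : (q * k : ℝ) / p ≤ ((q * k / p : ℕ) : ℝ) + 1 := by
    rw [div_le_iff₀ hp']
    have : q * k ≤ (q * k / p + 1) * p := (Nat.lt_div_mul_add hp).le.trans_eq (by ring)
    exact_mod_cast this
  have h3 : (k : ℝ) / p = (q * k : ℝ) / p / q := by field_simp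
  rw [h3, ← sub_div]
  constructor
  · exact div_nonneg (by linarith) hq'.le
  · gcongr; linarith

/-- Distances of the frequencies of two distinct signals. -/
theorem frequency_offset_bounds {q : ℕ} (hq : 0 < q) (hτ : StrictMono τ) (hδ : 2 / (q : ℝ) ≤ δ)
    (hsep : δ ≤ separation τ) {l l' : Fin s} (hl : l' ≠ l) {x : ℝ}
    (hx : x = ((q * τ l / p : ℕ) : ℝ) / q - ((τ l' : ℕ) : ℝ) / p) :
    |(((l' : ℕ) : ℝ) - ((l : ℕ) : ℝ))| * (δ / 2) ≤ |x| ∧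
      ((s : ℝ) - |(((l' : ℕ) : ℝ) - ((l : ℕ) : ℝ))|) * (δ / 2) ≤ 1 - |x| := by
  have hq' : (0 : ℝ) < q := by exact_mod_cast hq
  have hp : 0 < p := (τ l).pos
  have hp' : (0 : ℝ) < p := by exact_mod_cast hp
  have hδ0 : 0 < δ := lt_of_lt_of_le (by positivity) hδ
  -- Moving to the grid shifts a frequency by at most `1 / q ≤ δ / 2`. Both index distances are at
  -- least `1`, so this loses at most half of each distance; hence `δ / 2` in the conclusion.
  have hqδ : 1 / (q : ℝ) ≤ δ / 2 := by
    have : 2 / (q : ℝ) = 2 * (1 / q) := by ring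
    linarith
  obtain ⟨he0, he1⟩ := abs_sub_natDiv_le (k := τ l) hq hp
  set ε := ((τ l : ℕ) : ℝ) / p - ((q * τ l / p : ℕ) : ℝ) / q
  have hg := le_gap_of_le_separation hsep
  have main : ∀ i j : Fin s, i < j →
      1 ≤ ((j : ℕ) : ℝ) - ((i : ℕ) : ℝ) ∧ ((j : ℕ) : ℝ) - ((i : ℕ) : ℝ) ≤ s - 1 ∧
      (((j : ℕ) : ℝ) - ((i : ℕ) : ℝ)) * δ ≤ ((τ j : ℕ) : ℝ) / p - ((τ i : ℕ) : ℝ) / p ∧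
      ((s : ℝ) - (((j : ℕ) : ℝ) - ((i : ℕ) : ℝ))) * δ
        ≤ 1 - (((τ j : ℕ) : ℝ) / p - ((τ i : ℕ) : ℝ) / p) := by
    intro i j hij
    have h1 := mul_gap_le_sub hτ hg hij.le
    have h2 := mul_gap_le_wrap hτ hg i j
    have e1 : ((i : ℕ) : ℝ) + 1 ≤ ((j : ℕ) : ℝ) := by exact_mod_cast Fin.lt_def.1 hij
    have e2 : ((j : ℕ) : ℝ) + 1 ≤ s := by exact_mod_cast j.2
    have e3 : (0 : ℝ) ≤ ((i : ℕ) : ℝ) := Nat.cast_nonneg _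
    refine ⟨by linarith, by linarith, ?_, ?_⟩
    · rw [← sub_div, le_div_iff₀ hp']; linarith
    · rw [← sub_div, le_sub_iff_add_le, ← le_sub_iff_add_le', div_le_iff₀ hp']
      linarith
  rcases lt_or_gt_of_ne hl with h | h
  · obtain ⟨m1, m2, m3, m4⟩ := main l' l h
    have hxe : x = (((τ l : ℕ) : ℝ) / p - ((τ l' : ℕ) : ℝ) / p) - ε := by
      rw [hx]; simp only [ε]; ring
    have hx0 : 0 ≤ x := by nlinarith
    rw [abs_of_nonneg hx0, abs_sub_comm, abs_of_nonneg (by linarith)]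
    constructor <;> nlinarith
  · obtain ⟨m1, m2, m3, m4⟩ := main l l' h
    have hxe : -x = (((τ l' : ℕ) : ℝ) / p - ((τ l : ℕ) : ℝ) / p) + ε := by
      rw [hx]; simp only [ε]; ring
    have hx0 : x ≤ 0 := by nlinarith
    rw [abs_of_nonpos hx0, abs_of_nonneg (by linarith)]
    constructor <;> nlinarith

/-- On either side of `l` the index distances are distinct integers between `1` and `s`, and so are
their complements to `s`. This makes four partial harmonic sums. -/
theorem sum_one_div_index_distance_le (l : Fin s) :
    ∑ l' ∈ Finset.univ.erase l, (1 / |(((l' : ℕ) : ℝ) - ((l : ℕ) : ℝ))| +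
      1 / ((s : ℝ) - |(((l' : ℕ) : ℝ) - ((l : ℕ) : ℝ))|)) ≤ 4 * (1 + Real.log s) := by
  classical
  set S := (Finset.univ : Finset (Fin s)).erase l
  have hsplit := Finset.sum_filter_add_sum_filter_not S (fun l' => l' < l)
    (fun l' => 1 / |(((l' : ℕ) : ℝ) - ((l : ℕ) : ℝ))| +
      1 / ((s : ℝ) - |(((l' : ℕ) : ℝ) - ((l : ℕ) : ℝ))|))
  rw [← hsplit]
  have hlo : ∑ l' ∈ S.filter (fun l' => l' < l), (1 / |(((l' : ℕ) : ℝ) - ((l : ℕ) : ℝ))| +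
      1 / ((s : ℝ) - |(((l' : ℕ) : ℝ) - ((l : ℕ) : ℝ))|)) ≤ 2 * (1 + Real.log s) := by
    have h1 := sum_one_div_le_one_add_log (S := S.filter (fun l' => l' < l)) (s := s)
      (g := fun l' => (l : ℕ) - l')
      (fun i hi j hj hij => by simp at hi hj hij; ext; omega)
      (fun i hi => by simp at hi; omega) (fun i hi => by omega)
    have h2 := sum_one_div_le_one_add_log (S := S.filter (fun l' => l' < l)) (s := s)
      (g := fun l' => s - ((l : ℕ) - l'))
      (fun i hi j hj hij => by simp at hi hj hij; ext; omega)
      (fun i hi => by simp at hi; omega) (fun i hi => by omega)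
    refine le_of_eq_of_le ?_ ((add_le_add h1 h2).trans_eq (by ring))
    rw [← Finset.sum_add_distrib]
    refine Finset.sum_congr rfl fun i hi => ?_
    have hi' : i < l := (Finset.mem_filter.1 hi).2
    have hle : (i : ℕ) ≤ l := hi'.le
    have hle2 : (l : ℕ) - i ≤ s := by omega
    rw [Nat.cast_sub hle2, Nat.cast_sub hle, abs_sub_comm, abs_of_nonneg]
    exact sub_nonneg.2 (by exact_mod_cast hle)
  have hhi : ∑ l' ∈ S.filter (fun l' => ¬ l' < l), (1 / |(((l' : ℕ) : ℝ) - ((l : ℕ) : ℝ))| +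
      1 / ((s : ℝ) - |(((l' : ℕ) : ℝ) - ((l : ℕ) : ℝ))|)) ≤ 2 * (1 + Real.log s) := by
    have hmem : ∀ i ∈ S.filter (fun l' => ¬ l' < l), (l : ℕ) < i := by
      intro i hi
      have h1 := Finset.mem_filter.1 hi
      have h2 := (Finset.mem_erase.1 h1.1).1
      exact Fin.lt_def.1 (lt_of_le_of_ne (not_lt.1 h1.2) (Ne.symm h2))
    have h1 := sum_one_div_le_one_add_log (S := S.filter (fun l' => ¬ l' < l)) (s := s)
      (g := fun l' => (l' : ℕ) - l)
      (fun i hi j hj hij => by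
        have := hmem i hi; have := hmem j hj; simp only at hij; ext; omega)
      (fun i hi => by have := hmem i hi; omega) (fun i hi => by omega)
    have h2 := sum_one_div_le_one_add_log (S := S.filter (fun l' => ¬ l' < l)) (s := s)
      (g := fun l' => s - ((l' : ℕ) - l))
      (fun i hi j hj hij => by
        have := hmem i hi; have := hmem j hj; simp only at hij; ext; omega)
      (fun i hi => by have := hmem i hi; omega) (fun i hi => by omega)
    refine le_of_eq_of_le ?_ ((add_le_add h1 h2).trans_eq (by ring))
    rw [← Finset.sum_add_distrib]
    refine Finset.sum_congr rfl fun i hi => ?_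
    have hle : (l : ℕ) ≤ i := (hmem i hi).le
    have hle2 : (i : ℕ) - l ≤ s := by omega
    rw [Nat.cast_sub hle2, Nat.cast_sub hle, abs_of_nonneg]
    exact sub_nonneg.2 (by exact_mod_cast hle)
  linarith

/-- The amplitude of the transformed signal at the frequency nearest to `τ_l / p`. -/
theorem le_norm_signalMean {q N : ℕ} (hN : 0 < N) (hq : 0 < q) (hτ : StrictMono τ)
    (hδ : 2 / (q : ℝ) ≤ δ) (hsep : δ ≤ separation τ) {b : Fin s → ℂ} {A : ℝ}
    (hb : ∀ l, ‖b l‖ = A) (l : Fin s) (m : Fin q) (hm : (m : ℕ) = q * τ l / p) :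
    A * √((N : ℝ) / p) * (1 - 2 * Real.pi * N / q - 4 * (1 + Real.log s) / (N * δ))
      ≤ ‖signalMean q N p (sparseVector τ b) m‖ := by
  classical
  have hq' : (0 : ℝ) < q := by exact_mod_cast hq
  have hN' : (0 : ℝ) < N := by exact_mod_cast hN
  have hδ0 : 0 < δ := lt_of_lt_of_le (by positivity) hδ
  have hA : 0 ≤ A := hb l ▸ norm_nonneg _
  rw [signalMean_sparseVector, hm, ← Finset.add_sum_erase _ _ (Finset.mem_univ l)]
  set B := A * √((N : ℝ) / p)
  have hB : 0 ≤ B := by positivity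
  let K : Fin s → ℂ := fun l' =>
    dirichletKernel N (((q * τ l / p : ℕ) : ℝ) / q - ((τ l' : ℕ) : ℝ) / p)
  have hnorm : ∀ l', ‖b l' * (√((N : ℝ) / p) : ℝ) * K l'‖ = B * ‖K l'‖ := by
    intro l'
    rw [norm_mul, norm_mul, hb, Complex.norm_real, Real.norm_of_nonneg (Real.sqrt_nonneg _)]
  have hmain : B * (1 - 2 * Real.pi * N / q) ≤ ‖b l * (√((N : ℝ) / p) : ℝ) * K l‖ := by
    rw [hnorm]
    gcongr
    obtain ⟨he0, he1⟩ := abs_sub_natDiv_le (k := τ l) hq (τ l).pos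
    have h1 := norm_dirichletKernel_sub_one_le hN
      (((q * τ l / p : ℕ) : ℝ) / q - ((τ l : ℕ) : ℝ) / p)
    have h2 : |((q * τ l / p : ℕ) : ℝ) / q - ((τ l : ℕ) : ℝ) / p| ≤ 1 / q := by
      rw [abs_sub_comm, abs_of_nonneg he0]; exact he1
    have h3 : 2 * Real.pi * N * |((q * τ l / p : ℕ) : ℝ) / q - ((τ l : ℕ) : ℝ) / p|
        ≤ 2 * Real.pi * N * (1 / q) := by gcongr
    have h4 : (1 : ℝ) ≤ ‖K l‖ + ‖K l - 1‖ := by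
      have := norm_sub_le (K l) (K l - 1)
      rwa [sub_sub_cancel, norm_one] at this
    have h5 : 2 * Real.pi * N * (1 / (q : ℝ)) = 2 * Real.pi * N / q := by ring
    have h6 : ‖K l - 1‖ ≤ 2 * Real.pi * N / q := h5 ▸ h1.trans h3
    linarith
  have hrest : ‖∑ l' ∈ Finset.univ.erase l, b l' * (√((N : ℝ) / p) : ℝ) * K l'‖
      ≤ B * (4 * (1 + Real.log s) / (N * δ)) := by
    refine (norm_sum_le _ _).trans ?_
    simp only [hnorm]
    rw [← Finset.mul_sum]
    gcongr
    -- The kernel bound `1 / (2 N)` times reciprocal distances, with distances measured in units of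
    -- `δ / 2`, gives the prefactor `1 / (N δ)`.
    have hK : ∀ l' ∈ Finset.univ.erase l, ‖K l'‖ ≤ 1 / (N * δ) *
        (1 / |(((l' : ℕ) : ℝ) - ((l : ℕ) : ℝ))| +
          1 / ((s : ℝ) - |(((l' : ℕ) : ℝ) - ((l : ℕ) : ℝ))|)) := by
      intro l' hl'
      have hne : l' ≠ l := (Finset.mem_erase.1 hl').1
      obtain ⟨o1, o2⟩ := frequency_offset_bounds hq hτ hδ hsep hne rfl
      set x := ((q * τ l / p : ℕ) : ℝ) / q - ((τ l' : ℕ) : ℝ) / p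
      have d0 : 0 < |(((l' : ℕ) : ℝ) - ((l : ℕ) : ℝ))| := by
        rw [abs_pos, sub_ne_zero]
        exact_mod_cast fun h => hne (Fin.ext h)
      have d1 : 0 < (s : ℝ) - |(((l' : ℕ) : ℝ) - ((l : ℕ) : ℝ))| := by
        have a1 : ((l : ℕ) : ℝ) < s := by exact_mod_cast l.2
        have a2 : ((l' : ℕ) : ℝ) < s := by exact_mod_cast l'.2
        have a3 : (0 : ℝ) ≤ ((l : ℕ) : ℝ) := Nat.cast_nonneg _
        have a4 : (0 : ℝ) ≤ ((l' : ℕ) : ℝ) := Nat.cast_nonneg _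
        rw [sub_pos, abs_lt]
        constructor <;> linarith
      set d := |(((l' : ℕ) : ℝ) - ((l : ℕ) : ℝ))|
      have x0 : 0 < |x| := lt_of_lt_of_le (by positivity) o1
      have x1 : 0 < 1 - |x| := lt_of_lt_of_le (by positivity) o2
      calc ‖K l'‖ ≤ 1 / (2 * N) * (1 / |x| + 1 / (1 - |x|)) :=
            norm_dirichletKernel_le hN x0 (by linarith)
        _ ≤ 1 / (2 * N) * (1 / (d * (δ / 2)) + 1 / ((s - d) * (δ / 2))) := by gcongr
        _ = _ := by field_simp
    calc ∑ l' ∈ Finset.univ.erase l, ‖K l'‖ ≤ _ := Finset.sum_le_sum hK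
      _ ≤ 1 / (N * δ) * (4 * (1 + Real.log s)) := by
          rw [← Finset.mul_sum]
          gcongr
          exact sum_one_div_index_distance_le l
      _ = _ := by ring
  have htri := norm_sub_le (b l * (√((N : ℝ) / p) : ℝ) * K l
    + ∑ l' ∈ Finset.univ.erase l, b l' * (√((N : ℝ) / p) : ℝ) * K l')
    (∑ l' ∈ Finset.univ.erase l, b l' * (√((N : ℝ) / p) : ℝ) * K l')
  rw [add_sub_cancel_right] at htri
  have hfin : B * (1 - 2 * Real.pi * N / q - 4 * (1 + Real.log s) / (N * δ))
      = B * (1 - 2 * Real.pi * N / q) - B * (4 * (1 + Real.log s) / (N * δ)) := by ring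
  rw [hfin]
  change _ ≤ ‖b l * (√((N : ℝ) / p) : ℝ) * K l
    + ∑ l' ∈ Finset.univ.erase l, b l' * (√((N : ℝ) / p) : ℝ) * K l'‖
  linarith

/-- The total excess of the tail probabilities under an alternative. -/
theorem le_sum_shiftTail_sub_tail {q N : ℕ} (hN : 0 < N) (hq : 0 < q) (hτ : StrictMono τ)
    (hδ : 2 / (q : ℝ) ≤ δ) (hsep : δ ≤ separation τ) {b : Fin s → ℂ} {A A₀ t : ℝ}
    (hb : ∀ l, ‖b l‖ = A)
    (hA : A₀ ≤ A * √((N : ℝ) / p) * (1 - 2 * Real.pi * N / q - 4 * (1 + Real.log s) / (N * δ))) :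
    s * (Real.exp (-(max (t - A₀) 0 + 2) ^ 2) - tail t)
      ≤ ∑ m, (shiftTail t (signalMean q N p (sparseVector τ b) m) - tail t) := by
  classical
  have hδ0 : 0 < δ := lt_of_lt_of_le (by positivity) hδ
  let f : Fin s → Fin q := fun l => ⟨q * τ l / p, by
    rw [Nat.div_lt_iff_lt_mul (τ l).pos]
    exact Nat.mul_lt_mul_of_pos_left (τ l).2 hq⟩
  -- Distinct signals must occupy distinct grid frequencies, or their excess would be counted twice.
  -- The gap is at least `p δ ≥ 2 p / q`, so `q τ_l` increases by at least `p` and its quotient by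
  -- `p` strictly increases.
  have hfmono : StrictMono f := by
    intro l l' hll
    have hp : 0 < p := (τ l).pos
    have hp' : (0 : ℝ) < p := by exact_mod_cast hp
    have hq' : (0 : ℝ) < q := by exact_mod_cast hq
    have hg := mul_gap_le_sub hτ (le_gap_of_le_separation hsep) hll.le
    have e1 : ((l : ℕ) : ℝ) + 1 ≤ ((l' : ℕ) : ℝ) := by exact_mod_cast Fin.lt_def.1 hll
    have h1 : (p : ℝ) * δ ≤ ((τ l' : ℕ) : ℝ) - ((τ l : ℕ) : ℝ) := by
      have : 0 < (p : ℝ) * δ := by positivity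
      nlinarith
    have h2 : (2 : ℝ) ≤ δ * q := (div_le_iff₀ hq').1 hδ
    have h3 : (q : ℝ) * (τ l : ℕ) + p ≤ q * (τ l' : ℕ) := by nlinarith
    have h4 : q * (τ l : ℕ) + p ≤ q * (τ l' : ℕ) := by exact_mod_cast h3
    rw [Fin.lt_def]
    calc q * (τ l : ℕ) / p < q * (τ l : ℕ) / p + 1 := Nat.lt_succ_self _
      _ = (q * (τ l : ℕ) + p) / p := (Nat.add_div_right _ hp).symm
      _ ≤ q * (τ l' : ℕ) / p := Nat.div_le_div_right h4
  calc s * (Real.exp (-(max (t - A₀) 0 + 2) ^ 2) - tail t)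
      = ∑ _l : Fin s, (Real.exp (-(max (t - A₀) 0 + 2) ^ 2) - tail t) := by
        simp [mul_sub]
    _ ≤ ∑ l, (shiftTail t (signalMean q N p (sparseVector τ b) (f l)) - tail t) := by
        refine Finset.sum_le_sum fun l _ => ?_
        gcongr
        refine le_trans ?_ (exp_neg_le_stdComplexNormal_real _)
        have := hA.trans (le_norm_signalMean hN hq hτ hδ hsep hb l (f l) rfl)
        gcongr
    _ = ∑ m ∈ Finset.univ.image f,
          (shiftTail t (signalMean q N p (sparseVector τ b) m) - tail t) :=
        (Finset.sum_image (f := fun m => shiftTail t (signalMean q N p (sparseVector τ b) m) - tail t)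
          fun _ _ _ _ h => hfmono.injective h).symm
    _ ≤ _ := by
        -- The remaining frequencies are discarded; Anderson's inequality makes their terms
        -- nonnegative.
        refine Finset.sum_le_sum_of_subset_of_nonneg (Finset.subset_univ _) fun m _ _ => ?_
        exact sub_nonneg.2 (tail_le_stdComplexNormal_real t _)

end Separation

/-! ### Exponents above the detection boundary -/

/-- A level `h` and a decay exponent `κ` exist as soon as a limiting level works. -/
theorem exists_exponents_of_limit {c a r h₀ : ℝ} (hh₀ : 0 < h₀) (hc : h₀ ≤ c)
    (h1 : max (√h₀ - √r) 0 ^ 2 < h₀) (h2 : c - h₀ < 2 * (a - max (√h₀ - √r) 0 ^ 2)) :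
    ∃ h κ : ℝ, 0 < h ∧ h < c ∧ 0 < κ ∧ κ < h ∧ √h - √r < √κ ∧ c - h < 2 * (a - κ) := by
  have hw : Continuous fun h : ℝ => max (√h - √r) 0 ^ 2 := by fun_prop
  have e1 : ∀ᶠ h in 𝓝 h₀, max (√h - √r) 0 ^ 2 < h :=
    hw.continuousAt.eventually_lt continuousAt_id h1
  have e2 : ∀ᶠ h in 𝓝 h₀, c - h < 2 * (a - max (√h - √r) 0 ^ 2) :=
    (continuous_const.sub continuous_id).continuousAt.eventually_lt
      (continuous_const.mul (continuous_const.sub hw)).continuousAt h2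
  -- Approaching `h₀` from the left keeps `h < c` strict even if `h₀ = c`. This later leaves room
  -- for the upper limit `√(log (N / 3))` on the level.
  have e3 : ∀ᶠ h in 𝓝[<] h₀, h < h₀ := eventually_mem_nhdsWithin
  have e4 : ∀ᶠ h in 𝓝 h₀, 0 < h := lt_mem_nhds hh₀
  obtain ⟨h, hh, hh1, hh2, hh3⟩ := (e3.and ((e1.and (e2.and e4)).filter_mono
    nhdsWithin_le_nhds)).exists
  obtain ⟨κ, hκ1, hκ2⟩ : ∃ κ, max (√h - √r) 0 ^ 2 < κ ∧ κ < min h (a - (c - h) / 2) :=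
    exists_between (lt_min hh1 (by linarith))
  refine ⟨h, κ, hh3, hh.trans_le hc, (sq_nonneg _).trans_lt hκ1, hκ2.trans_le (min_le_left _ _),
    (le_max_left _ 0).trans_lt (Real.lt_sqrt_of_sq_lt hκ1), ?_⟩
  have := hκ2.trans_le (min_le_right _ _)
  linarith

theorem detectionBoundary_nonneg {γ α : ℝ} (hα0 : (1 + γ) / 2 < α) :
    0 ≤ detectionBoundary γ α := by
  rw [detectionBoundary]
  split_ifs
  · positivity
  · linarith

/-- Above the detection boundary there is a level at which the signals are visible. -/
theorem exists_exponents {γ α r : ℝ} (hγ1 : γ < 1) (hα0 : (1 + γ) / 2 < α) (hα1 : α < 1)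
    (hr : detectionBoundary γ α < r) :
    ∃ h κ : ℝ, 0 < h ∧ h < 1 - γ ∧ 0 < κ ∧ κ < h ∧ √h - √r < √κ ∧
      1 - γ - h < 2 * (1 - α - κ) := by
  have hr0 : 0 < r := (detectionBoundary_nonneg hα0).trans_lt hr
  have hc : 0 < 1 - γ := by linarith
  have ha : 0 < 1 - α := by linarith
  have hsc : 0 < √(1 - γ) := Real.sqrt_pos.2 hc
  have sqc : √(1 - γ) ^ 2 = 1 - γ := Real.sq_sqrt hc.le
  have sqa : √(1 - α) ^ 2 = 1 - α := Real.sq_sqrt ha.le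
  rw [detectionBoundary] at hr
  split_ifs at hr with hcase
  -- Sparsest regime: the highest level `h₀ = 1 - γ` is used, and the condition becomes `(√(1 - γ) -
  -- √r)₊² < 1 - α`.
  · have h1 : √(1 - γ) - √r < √(1 - α) := by
      have := Real.lt_sqrt_of_sq_lt hr
      linarith
    have h2 : max (√(1 - γ) - √r) 0 ^ 2 < 1 - α := by
      rw [← sqa]
      have : 0 < √(1 - α) := Real.sqrt_pos.2 ha
      have hm : max (√(1 - γ) - √r) 0 < √(1 - α) := max_lt h1 this
      gcongr
    exact exists_exponents_of_limit hc le_rfl (by linarith) (by linarith)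
  -- The optimal level is `4 r`, capped at `1 - γ`. Below the cap the decay exponent is `r`, and the
  -- condition reads `r > α - 1/2 - γ/2`. At the cap the exponent is at most `(1 - γ) / 4`, which is
  -- below `1 - α` in this regime.
  · rcases lt_or_ge (4 * r) (1 - γ) with h4 | h4
    · have h1 : √(4 * r) - √r = √r := by
        rw [Real.sqrt_mul (by norm_num), show (4 : ℝ) = 2 ^ 2 by norm_num,
          Real.sqrt_sq (by norm_num)]
        ring
      have h2 : max (√(4 * r) - √r) 0 ^ 2 = r := by
        rw [h1, max_eq_left (Real.sqrt_nonneg _), Real.sq_sqrt hr0.le]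
      refine exists_exponents_of_limit (h₀ := 4 * r) (by positivity) h4.le ?_ ?_ <;> rw [h2] <;>
        linarith
    · have h1 : √(1 - γ) / 2 ≤ √r := by
        apply Real.le_sqrt_of_sq_le
        rw [div_pow, sqc]; linarith
      have h2 : max (√(1 - γ) - √r) 0 ^ 2 ≤ (1 - γ) / 4 := by
        have hm : max (√(1 - γ) - √r) 0 ≤ √(1 - γ) / 2 := max_le (by linarith) (by positivity)
        calc max (√(1 - γ) - √r) 0 ^ 2 ≤ (√(1 - γ) / 2) ^ 2 := by gcongr
          _ = _ := by rw [div_pow, sqc]; norm_num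
      exact exists_exponents_of_limit hc le_rfl (by linarith) (by linarith)

/-! ### Asymptotics of the two error probabilities -/

theorem tendsto_add_pow_mul_exp_neg {ε : ℝ} (hε : 0 < ε) (c : ℝ) (k : ℕ) :
    Tendsto (fun x : ℝ => (x + c) ^ k * Real.exp (-(ε * x))) atTop (𝓝 0) := by
  have h := (isLittleO_pow_exp_pos_mul_atTop k hε).tendsto_div_nhds_zero
  have h2 := (h.comp (tendsto_atTop_add_const_right atTop c tendsto_id)).mul_const
    (Real.exp (ε * c))
  rw [zero_mul] at h2
  refine h2.congr fun x => ?_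
  simp only [Function.comp, id]
  rw [mul_add, Real.exp_add, Real.exp_neg]
  field_simp

/-- The level of the test tends to `0`. -/
theorem tendsto_level {N : ℕ → ℕ} (hN : Tendsto N atTop atTop) :
    Tendsto (fun n => (⌊Real.log (N n) + 1⌋₊ : ℝ) * N n *
      Real.exp (2 - Real.log (N n) ^ 2 / (4 * √(⌊Real.log (N n) + 1⌋₊ : ℝ)))) atTop (𝓝 0) := by
  have hℓ : Tendsto (fun n => Real.log (N n)) atTop atTop :=
    Real.tendsto_log_atTop.comp (tendsto_natCast_atTop_atTop.comp hN)
  have hlim : Tendsto (fun n => Real.exp (2 - Real.log (N n))) atTop (𝓝 0) :=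
    Real.tendsto_exp_atBot.comp (tendsto_atBot_add_const_left atTop 2 (tendsto_neg_atTop_atBot.comp hℓ))
  refine squeeze_zero' (Eventually.of_forall fun n => by positivity) ?_ hlim
  -- The threshold `200` ensures `√(ℓ + 1) ≤ ℓ / 12`, so the exponent exceeds `3 ℓ` while `L N ≤ exp
  -- (2 ℓ)`.
  filter_upwards [hℓ.eventually_ge_atTop 200, hN.eventually_ge_atTop 1] with n hn hn1
  set ℓ := Real.log (N n)
  set L : ℝ := (⌊ℓ + 1⌋₊ : ℝ)
  have hNe : (N n : ℝ) = Real.exp ℓ := (Real.exp_log (by exact_mod_cast hn1)).symm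
  have hL : L ≤ ℓ + 1 := Nat.floor_le (by linarith)
  have hL' : ℓ < L := by
    have := Nat.lt_floor_add_one (ℓ + 1)
    simp only [L]; linarith
  have hL0 : 0 < √L := Real.sqrt_pos.2 (by linarith)
  have hsq : √L ≤ ℓ / 12 := by
    rw [Real.sqrt_le_left (by linarith)]
    nlinarith
  have hquot : 3 * ℓ ≤ ℓ ^ 2 / (4 * √L) := by
    rw [le_div_iff₀ (by positivity)]
    nlinarith
  have hexp : L ≤ Real.exp ℓ := hL.trans (Real.add_one_le_exp ℓ)
  calc L * N n * Real.exp (2 - ℓ ^ 2 / (4 * √L))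
      ≤ Real.exp ℓ * Real.exp ℓ * Real.exp (2 - 3 * ℓ) := by rw [hNe]; gcongr
    _ = Real.exp (2 - ℓ) := by rw [← Real.exp_add, ← Real.exp_add]; congr 1; ring

/-- The type II error at a fixed sample size. -/
theorem iSup_obsLaw_compl_ophcReject_le {N p s L : ℕ} {r t A₀ D : ℝ}
    (hL : L = ⌊Real.log N + 1⌋₊) (hN : 0 < N) (hp : 0 < p) (hLpos : 0 < L)
    (ht : 1 ≤ t) (ht' : t ≤ √(Real.log ((N : ℝ) / 3)))
    (hδ : 2 / ((N * L : ℕ) : ℝ) ≤ Real.log N ^ 2 / N)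
    (hA : A₀ ≤ √(r * Real.log p) *
      (1 - 2 * Real.pi / L - 4 * (1 + Real.log s) / Real.log N ^ 2))
    (hD : 0 < D)
    (hDs : D ≤ s * (Real.exp (-(max (t - A₀) 0 + 2) ^ 2) - tail t))
    (hTD : 2 * Real.log N ^ 2 * √(N * L * tail t) ≤ D) :
    ⨆ x ∈ paramSpace p N s r, obsLaw N p (sparseVector x.1 x.2) (ophcReject N)ᶜ
      ≤ ENNReal.ofReal (4 * L * (N * L * tail t / D ^ 2 + 1 / D)) := by
  refine iSup₂_le fun x hx => ?_
  obtain ⟨hτ, hb, hsep⟩ := hx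
  rw [ophcReject, ← hL]
  refine obsLaw_compl_rejectionRegion_le (by linarith) ht ht' (sq_nonneg _) hD ?_ hTD
  refine hDs.trans ?_
  have hN' : (0 : ℝ) < N := by exact_mod_cast hN
  have hp' : (0 : ℝ) < p := by exact_mod_cast hp
  have hL' : (0 : ℝ) < L := by exact_mod_cast hLpos
  refine le_sum_shiftTail_sub_tail hN (Nat.mul_pos hN hLpos) hτ hδ hsep hb (hA.trans_eq ?_)
  -- The calibration of the coefficients cancels the energy factor `N / p` of the extended design,
  -- leaving amplitude `√(r log p)`.
  have e1 : √(r * p * Real.log p / N) * √((N : ℝ) / p) = √(r * Real.log p) := by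
    rw [← Real.sqrt_mul' _ (by positivity)]
    congr 1
    field_simp
  have e2 : 2 * Real.pi * N / ((N * L : ℕ) : ℝ) = 2 * Real.pi / L := by
    push_cast; field_simp
  have e3 : (N : ℝ) * (Real.log N ^ 2 / N) = Real.log N ^ 2 := by field_simp
  rw [e1, e2, e3]

theorem tendsto_log_of_rpow {p N : ℕ → ℕ} {c : ℝ} (hc : 0 < c) (hN : Tendsto N atTop atTop)
    (hNp : ∀ n, |(N n : ℝ) - (p n : ℝ) ^ c| < 1) :
    Tendsto (fun n => Real.log (p n)) atTop atTop := by
  have h1 : Tendsto (fun n => (p n : ℝ) ^ c) atTop atTop := by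
    refine tendsto_atTop_mono (fun n => ?_)
      (tendsto_atTop_add_const_right atTop (-1 : ℝ) (tendsto_natCast_atTop_atTop.comp hN))
    have := (abs_lt.1 (hNp n)).2
    simp only [Function.comp]
    linarith
  have h2 : Tendsto (fun n => Real.log ((p n : ℝ) ^ c) / c) atTop atTop :=
    (Real.tendsto_log_atTop.comp h1).atTop_div_const hc
  refine h2.congr' ?_
  filter_upwards [h1.eventually_gt_atTop 0] with n hn
  have hp : (0 : ℝ) < p n := by
    rcases (Nat.cast_nonneg (α := ℝ) (p n)).eq_or_lt with h | h
    · rw [← h, Real.zero_rpow hc.ne'] at hn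
      exact absurd hn (lt_irrefl _)
    · exact h
  rw [Real.log_rpow hp, mul_div_cancel_left₀ _ hc.ne']

theorem eventually_half_exp_le {p M : ℕ → ℕ} {c : ℝ} (hc : 0 < c)
    (hP : Tendsto (fun n => Real.log (p n)) atTop atTop)
    (hMp : ∀ n, |(M n : ℝ) - (p n : ℝ) ^ c| < 1) :
    ∀ᶠ n in atTop, Real.exp (c * Real.log (p n)) / 2 ≤ M n ∧
      (M n : ℝ) ≤ 2 * Real.exp (c * Real.log (p n)) := by
  have h1 : Tendsto (fun n => Real.exp (c * Real.log (p n))) atTop atTop :=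
    Real.tendsto_exp_atTop.comp (hP.const_mul_atTop hc)
  filter_upwards [h1.eventually_ge_atTop 2, hP.eventually_gt_atTop 0] with n hn hn0
  -- The case `p n = 0` is excluded because `Real.log 0 = 0`.
  have hp : (0 : ℝ) < p n := by
    rcases (Nat.cast_nonneg (α := ℝ) (p n)).eq_or_lt with h | h
    · rw [← h, Real.log_zero] at hn0
      exact absurd hn0 (lt_irrefl _)
    · exact h
  have h2 := abs_lt.1 (hMp n)
  rw [Real.rpow_def_of_pos hp, mul_comm] at h2
  constructor <;> linarith [h2.1, h2.2]

/-- An explicit bound for the type II error, under the size relations that hold for large `p`. -/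
theorem iSup_obsLaw_compl_ophcReject_le_exp {N p s L : ℕ} {r h κ c a ε P ℓ η : ℝ}
    (hPdef : P = Real.log p) (hℓdef : ℓ = Real.log N) (hLdef : L = ⌊ℓ + 1⌋₊)
    (hηdef : η = 2 * Real.pi / L + 4 * (1 + Real.log s) / ℓ ^ 2)
    (hεdef : ε = 2 * (a - κ) - (c - h)) (hh0 : 0 < h) (hκ0 : 0 < κ)
    (hNn : Real.exp (c * P) / 2 ≤ N ∧ (N : ℝ) ≤ 2 * Real.exp (c * P))
    (hsn : Real.exp (a * P) / 2 ≤ s)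
    (hℓn : c * P - 1 ≤ ℓ ∧ ℓ ≤ P + 1) (hLn : ℓ ≤ L ∧ (L : ℝ) ≤ ℓ + 1)
    (hampn : max (√(h * P) - √(r * P) * (1 - η)) 0 + 2 ≤ √(κ * P))
    (hP1 : 1 ≤ P * h) (hP2 : 3 ≤ P * (c - h)) (hP3 : 1 ≤ P * (h - κ)) (hℓ2 : 2 ≤ ℓ)
    (hpolyn : (P + 2) ^ 5 * Real.exp (-(ε * P)) < 1 / 128) (hP0 : 0 < P) (hN0 : 0 < N) :
    ⨆ x ∈ paramSpace p N s r, obsLaw N p (sparseVector x.1 x.2) (ophcReject N)ᶜ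
      ≤ ENNReal.ofReal (128 * ((P + 2) ^ 2 * Real.exp (-(ε * P)))
        + 16 * ((P + 2) ^ 1 * Real.exp (-((a - κ) * P)))) := by
  have hlog3 : Real.log 3 ≤ 2 := by
    linarith [Real.log_le_sub_one_of_pos (show (0 : ℝ) < 3 by norm_num)]
  have hN0' : (0 : ℝ) < N := by exact_mod_cast hN0
  have hL0' : (0 : ℝ) < L := by linarith [hLn.1]
  have hL0 : 0 < L := by exact_mod_cast hL0'
  have hp0 : 0 < p := by
    rcases Nat.eq_zero_or_pos (p) with h | h
    · simp [hPdef, h] at hP0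
    · exact h
  have ht0 : 0 ≤ √(h * P) := Real.sqrt_nonneg _
  have htail : tail (√(h * P)) = Real.exp (-(h * P)) := by
    rw [tail_eq ht0, Real.sq_sqrt (by positivity)]
  have hLy : (L : ℝ) ≤ P + 2 := by linarith [hLn.2, hℓn.2]
  have hℓy : ℓ ≤ P + 2 := by linarith [hℓn.2]
  set y := P + 2
  have hy : 0 < y := by positivity
  -- One factor `1 / 2` comes from rounding `s`, the other from subtracting the null tail `exp (-h
  -- P)`, which is at most half of `exp (-κ P)`.
  set D := Real.exp ((a - κ) * P) / 4
  have hD : 0 < D := by positivity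
  have hD2 : D ^ 2 = Real.exp (ε * P) * Real.exp ((c - h) * P) / 16 := by
    simp only [D, div_pow]
    rw [← Real.exp_nat_mul, ← Real.exp_add]
    congr 1
    · congr 1
      rw [hεdef]
      push_cast; ring
    · norm_num
  have hNL : (N : ℝ) * L * tail (√(h * P)) ≤ 2 * y * Real.exp ((c - h) * P) := by
    rw [htail]
    calc (N : ℝ) * L * Real.exp (-(h * P))
        ≤ (2 * Real.exp (c * P)) * y * Real.exp (-(h * P)) := by
          gcongr
          exact hNn.2
      _ = 2 * y * Real.exp ((c - h) * P) := by
          rw [show (c - h) * P = c * P + -(h * P) by ring, Real.exp_add]; ring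
  -- Squaring the threshold condition `hTD` gives `(2 y²)² * 2 y = 128 y⁵ / 16`, to be compared with
  -- the `1 / 16` in `D²`.
  have hpoly' : 128 * y ^ 5 ≤ Real.exp (ε * P) := by
    have : y ^ 5 * Real.exp (-(ε * P)) < 1 / 128 := hpolyn
    rw [Real.exp_neg, ← div_eq_mul_inv, div_lt_iff₀ (Real.exp_pos _)] at this
    linarith
  have hTD : 2 * ℓ ^ 2 * √(N * L * tail (√(h * P))) ≤ D := by
    refine (sq_le_sq₀ (by positivity) hD.le).1 ?_
    rw [mul_pow, Real.sq_sqrt (by rw [htail]; positivity), hD2]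
    calc (2 * ℓ ^ 2) ^ 2 * (N * L * tail (√(h * P)))
        ≤ (2 * y ^ 2) ^ 2 * (2 * y * Real.exp ((c - h) * P)) := by
          have : 0 ≤ ℓ := by linarith
          gcongr
          rw [htail]; positivity
      _ = 128 * y ^ 5 * Real.exp ((c - h) * P) / 16 := by ring
      _ ≤ Real.exp (ε * P) * Real.exp ((c - h) * P) / 16 := by gcongr
  have hDs : D ≤ s * (Real.exp (-(max (√(h * P) - √(r * P) * (1 - η)) 0 + 2) ^ 2)
      - tail (√(h * P))) := by
    have e1 : Real.exp (-(κ * P))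
        ≤ Real.exp (-(max (√(h * P) - √(r * P) * (1 - η)) 0 + 2) ^ 2) := by
      have e0 : (max (√(h * P) - √(r * P) * (1 - η)) 0 + 2) ^ 2 ≤ κ * P := by
        rw [← Real.sq_sqrt (show 0 ≤ κ * P by positivity)]
        gcongr
      gcongr
    have e2 : Real.exp (-(h * P)) ≤ Real.exp (-(κ * P)) / 2 := by
      have e3 : Real.exp (-(h * P)) = Real.exp (-(κ * P)) * Real.exp (-(P * (h - κ))) := by
        rw [← Real.exp_add]; congr 1; ring
      have e4 : Real.exp (-(P * (h - κ))) ≤ 1 / 2 := by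
        have e5 : Real.exp (-(P * (h - κ))) ≤ Real.exp (-1) := by gcongr
        linarith [Real.exp_neg_one_lt_d9]
      rw [e3]
      calc _ ≤ Real.exp (-(κ * P)) * (1 / 2) := by gcongr
        _ = _ := by ring
    rw [htail]
    calc D = Real.exp (a * P) / 2 * (Real.exp (-(κ * P)) / 2) := by
          simp only [D]
          rw [show (a - κ) * P = a * P + -(κ * P) by ring, Real.exp_add]; ring
      _ ≤ s * (Real.exp (-(κ * P)) / 2) := by
          gcongr
      _ ≤ _ := by
          gcongr
          linarith
  have hA : √(r * P) * (1 - η) ≤ √(r * P) *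
      (1 - 2 * Real.pi / L - 4 * (1 + Real.log (s)) / ℓ ^ 2) := by
    rw [hηdef, sub_add_eq_sub_sub]
  have hδ : 2 / ((N * L : ℕ) : ℝ) ≤ ℓ ^ 2 / N := by
    push_cast
    rw [div_le_div_iff₀ (by positivity) hN0']
    have e1 : 1 ≤ (L : ℝ) := by linarith [hLn.1]
    have e2 : 2 ≤ ℓ ^ 2 := by nlinarith
    have e3 : 2 * 1 ≤ ℓ ^ 2 * L := mul_le_mul e2 e1 zero_le_one (by positivity)
    calc 2 * (N : ℝ) = N * (2 * 1) := by ring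
      _ ≤ N * (ℓ ^ 2 * L) := mul_le_mul_of_nonneg_left e3 hN0'.le
      _ = ℓ ^ 2 * (N * L) := by ring
  have ht1 : 1 ≤ √(h * P) := Real.one_le_sqrt.2 (by linarith)
  -- Rounding `N` costs `1` and `log 3` at most `2`; the margin `P (c - h) ≥ 3` covers both.
  have ht2 : √(h * P) ≤ √(Real.log ((N : ℝ) / 3)) := by
    apply Real.sqrt_le_sqrt
    rw [Real.log_div hN0'.ne' (by norm_num), ← hℓdef]
    linarith [hℓn.1]
  refine (iSup_obsLaw_compl_ophcReject_le (hℓdef ▸ hLdef) hN0 hp0 hL0 ht1 ht2 (hℓdef ▸ hδ)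
    (by rw [← hPdef, ← hℓdef]; exact hA) hD hDs (hℓdef ▸ hTD)).trans ?_
  apply ENNReal.ofReal_le_ofReal
  have f1 : (N : ℝ) * L * tail (√(h * P)) / D ^ 2 ≤ 32 * y * Real.exp (-(ε * P)) := by
    rw [div_le_iff₀ (by positivity), hD2]
    refine hNL.trans_eq ?_
    rw [Real.exp_neg]
    field_simp
    ring
  have f2 : 1 / D = 4 * Real.exp (-((a - κ) * P)) := by
    simp only [D]
    rw [Real.exp_neg]
    field_simp
  calc 4 * (L : ℝ) * (N * L * tail (√(h * P)) / D ^ 2 + 1 / D)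
      ≤ 4 * y * (32 * y * Real.exp (-(ε * P)) + 4 * Real.exp (-((a - κ) * P))) := by
        rw [f2]
        have : 0 ≤ tail (√(h * P)) := measureReal_nonneg
        gcongr
    _ = _ := by ring

/-- The type II error tends to `0`, uniformly over the parameter space. -/
theorem tendsto_iSup_obsLaw_compl_ophcReject {γ α r : ℝ} (hγ0 : 0 ≤ γ) (hγ1 : γ < 1)
    (hα0 : (1 + γ) / 2 < α) (hα1 : α < 1) (hr : detectionBoundary γ α < r) {p N s : ℕ → ℕ}
    (hN : Tendsto N atTop atTop)
    (hNp : ∀ n, |(N n : ℝ) - (p n : ℝ) ^ (1 - γ)| < 1)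
    (hsp : ∀ n, |(s n : ℝ) - (p n : ℝ) ^ (1 - α)| < 1) :
    Tendsto (fun n => ⨆ x ∈ paramSpace (p n) (N n) (s n) r,
      obsLaw (N n) (p n) (sparseVector x.1 x.2) (ophcReject (N n))ᶜ) atTop (𝓝 0) := by
  obtain ⟨h, κ, hh0, hhc, hκ0, hκh, hκr, hε⟩ := exists_exponents hγ1 hα0 hα1 hr
  have hr0 : 0 < r := (detectionBoundary_nonneg hα0).trans_lt hr
  set c := 1 - γ with hcdef
  set a := 1 - α with hadef
  have hc : 0 < c := by linarith
  have hc1 : c ≤ 1 := by linarith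
  have ha : 0 < a := by linarith
  have ha1 : a ≤ 1 := by linarith
  set ε := 2 * (a - κ) - (c - h)
  have hε0 : 0 < ε := by linarith
  have hε1 : 0 < a - κ := by linarith
  set P : ℕ → ℝ := fun n => Real.log (p n)
  have hP : Tendsto P atTop atTop := tendsto_log_of_rpow hc hN hNp
  set ℓ : ℕ → ℝ := fun n => Real.log (N n)
  have hℓ : Tendsto ℓ atTop atTop :=
    Real.tendsto_log_atTop.comp (tendsto_natCast_atTop_atTop.comp hN)
  set L : ℕ → ℕ := fun n => ⌊ℓ n + 1⌋₊
  have hNb := eventually_half_exp_le hc hP hNp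
  have hsb := eventually_half_exp_le ha hP hsp
  have hlog2 : Real.log 2 ≤ 1 := by linarith [Real.log_two_lt_d9]
  have hℓb : ∀ᶠ n in atTop, c * P n - 1 ≤ ℓ n ∧ ℓ n ≤ P n + 1 := by
    filter_upwards [hNb, hP.eventually_ge_atTop 0] with n hn hPn
    have hpos : (0 : ℝ) < N n := lt_of_lt_of_le (by positivity) hn.1
    have e1 := Real.log_le_log (by positivity) hn.1
    have e2 := Real.log_le_log hpos hn.2
    rw [Real.log_div (Real.exp_pos _).ne' two_ne_zero, Real.log_exp] at e1
    rw [Real.log_mul two_ne_zero (Real.exp_pos _).ne', Real.log_exp] at e2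
    have : c * P n ≤ 1 * P n := by gcongr
    constructor
    · simp only [ℓ, P] at *; linarith
    · simp only [ℓ, P] at *; linarith
  have hlogs : ∀ᶠ n in atTop, Real.log (s n) ≤ P n + 1 := by
    filter_upwards [hsb, hP.eventually_ge_atTop 0] with n hn hPn
    have hpos : (0 : ℝ) < s n := lt_of_lt_of_le (by positivity) hn.1
    have e2 := Real.log_le_log hpos hn.2
    rw [Real.log_mul two_ne_zero (Real.exp_pos _).ne', Real.log_exp] at e2
    have : a * P n ≤ 1 * P n := by gcongr
    simp only [P] at *; linarith
  have hLb : ∀ᶠ n in atTop, ℓ n ≤ L n ∧ (L n : ℝ) ≤ ℓ n + 1 := by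
    filter_upwards [hℓ.eventually_ge_atTop 0] with n hn
    have e1 : (L n : ℝ) ≤ ℓ n + 1 := Nat.floor_le (by linarith)
    have e2 : ℓ n + 1 < L n + 1 := Nat.lt_floor_add_one (ℓ n + 1)
    exact ⟨by linarith, e1⟩
  -- the loss of amplitude
  set η : ℕ → ℝ := fun n => 2 * Real.pi / L n + 4 * (1 + Real.log (s n)) / ℓ n ^ 2
  have hη : ∀ᶠ n in atTop, η n ≤ (2 * Real.pi + 4 * (2 / c + 3)) / ℓ n := by
    filter_upwards [hℓb, hlogs, hLb, hℓ.eventually_ge_atTop 1] with n h1 h2 h3 h4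
    have hℓ0 : 0 < ℓ n := by linarith
    have e1 : 2 * Real.pi / (L n : ℝ) ≤ 2 * Real.pi / ℓ n := by
      have := Real.pi_pos
      have := h3.1
      gcongr
    have e2 : P n ≤ 2 * ℓ n / c := by
      rw [le_div_iff₀ hc]; linarith [h1.1]
    have e3 : 1 + Real.log (s n) ≤ (2 / c + 3) * ℓ n := by
      have : (2 / c + 3) * ℓ n = 2 * ℓ n / c + 3 * ℓ n := by ring
      linarith
    have e4 : 4 * (1 + Real.log (s n)) / ℓ n ^ 2 ≤ 4 * ((2 / c + 3) * ℓ n) / ℓ n ^ 2 := by gcongr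
    have e5 : 4 * ((2 / c + 3) * ℓ n) / ℓ n ^ 2 = 4 * (2 / c + 3) / ℓ n := by field_simp
    simp only [η]
    rw [add_div]
    linarith
  have hamp : ∀ᶠ n in atTop, max (√(h * P n) - √(r * P n) * (1 - η n)) 0 + 2 ≤ √(κ * P n) := by
    set C := 2 * Real.pi + 4 * (2 / c + 3)
    have hsP : Tendsto (fun n => √(P n)) atTop atTop := Real.tendsto_sqrt_atTop.comp hP
    -- After division by `√P` the additive `2` and the relative amplitude loss of order `1 / ℓ`
    -- vanish, so the strict inequality `√h - √r < √κ` absorbs them. The branch where the maximum is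
    -- `0` needs only `κ > 0`.
    have hlim : Tendsto (fun n => √h - √r * (1 - C / ℓ n) + 2 / √(P n)) atTop
        (𝓝 (√h - √r * (1 - 0) + 0)) :=
      (tendsto_const_nhds.sub (tendsto_const_nhds.mul (tendsto_const_nhds.sub
        (hℓ.const_div_atTop C)))).add (hsP.const_div_atTop 2)
    have hlim2 : Tendsto (fun n => 0 + 2 / √(P n)) atTop (𝓝 (0 + 0)) :=
      tendsto_const_nhds.add (hsP.const_div_atTop 2)
    filter_upwards [hη, hlim.eventually_lt_const (u := √κ) (by linarith),
      hlim2.eventually_lt_const (u := √κ) (by simpa using hκ0),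
      hP.eventually_gt_atTop 0] with n h1 h2 h3 h4
    have hs0 : 0 < √(P n) := Real.sqrt_pos.2 h4
    rw [Real.sqrt_mul hh0.le, Real.sqrt_mul hr0.le, Real.sqrt_mul hκ0.le]
    have e1 : √r * (1 - C / ℓ n) ≤ √r * (1 - η n) := by gcongr
    have e2 : (2 : ℝ) = 2 / √(P n) * √(P n) := by field_simp
    have key : max (√h - √r * (1 - η n)) 0 + 2 / √(P n) ≤ √κ := by
      rw [max_add]
      exact max_le (by linarith) h3.le
    have e3 : max (√h * √(P n) - √r * √(P n) * (1 - η n)) 0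
        = max (√h - √r * (1 - η n)) 0 * √(P n) := by
      rw [max_mul_of_nonneg _ _ hs0.le, zero_mul]
      congr 1; ring
    rw [e3]
    calc _ = (max (√h - √r * (1 - η n)) 0 + 2 / √(P n)) * √(P n) := by rw [add_mul, ← e2]
      _ ≤ _ := by gcongr
  -- the bound on the error probability
  have hpoly := (tendsto_add_pow_mul_exp_neg hε0 2 5).comp hP
  have hbound : ∀ᶠ n in atTop, ⨆ x ∈ paramSpace (p n) (N n) (s n) r,
      obsLaw (N n) (p n) (sparseVector x.1 x.2) (ophcReject (N n))ᶜ
      ≤ ENNReal.ofReal (128 * ((P n + 2) ^ 2 * Real.exp (-(ε * P n)))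
        + 16 * ((P n + 2) ^ 1 * Real.exp (-((a - κ) * P n)))) := by
    filter_upwards [hNb, hsb, hℓb, hLb, hamp, hP.eventually_ge_atTop (1 / h),
      hP.eventually_ge_atTop (3 / (c - h)), hP.eventually_ge_atTop (1 / (h - κ)),
      hℓ.eventually_ge_atTop 2, hpoly.eventually_lt_const (u := 1 / 128) (by norm_num),
      hP.eventually_gt_atTop 0, hN.eventually_gt_atTop 0] with
      n hNn hsn hℓn hLn hampn hP1 hP2 hP3 hℓ2 hpolyn hP0 hN0
    rw [div_le_iff₀ (by linarith)] at hP1 hP2 hP3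
    exact iSup_obsLaw_compl_ophcReject_le_exp rfl rfl rfl rfl rfl hh0 hκ0 hNn hsn.1 hℓn hLn hampn
      hP1 hP2 hP3 hℓ2 hpolyn hP0 hN0
  have hlim : Tendsto (fun n => ENNReal.ofReal (128 * ((P n + 2) ^ 2 * Real.exp (-(ε * P n)))
        + 16 * ((P n + 2) ^ 1 * Real.exp (-((a - κ) * P n))))) atTop (𝓝 0) := by
    have h1 := ((tendsto_add_pow_mul_exp_neg hε0 2 2).comp hP).const_mul 128
    have h2 := ((tendsto_add_pow_mul_exp_neg hε1 2 1).comp hP).const_mul 16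
    have h3 := ENNReal.tendsto_ofReal (h1.add h2)
    simpa using h3
  exact tendsto_of_tendsto_of_tendsto_of_le_of_le' tendsto_const_nhds hlim
    (Eventually.of_forall fun _ => zero_le) hbound

/-- The type I error tends to `0`. -/
theorem tendsto_obsLaw_zero_ophcReject {p N : ℕ → ℕ} (hN : Tendsto N atTop atTop) :
    Tendsto (fun n => obsLaw (N n) (p n) 0 (ophcReject (N n))) atTop (𝓝 0) := by
  have h := ENNReal.tendsto_ofReal (tendsto_level hN)
  rw [ENNReal.ofReal_zero] at h
  exact tendsto_of_tendsto_of_tendsto_of_le_of_le tendsto_const_nhds h (fun _ => zero_le)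
    fun n => obsLaw_zero_rejectionRegion_le (sq_nonneg _)

end OPHC

theorem theorem2p1 (γ α r : ℝ) (hγ0 : 0 ≤ γ) (hγ1 : γ < 1)
    (hα0 : (1 + γ) / 2 < α) (hα1 : α < 1)
    (hr : OPHC.detectionBoundary γ α < r)
    (p N s : ℕ → ℕ)
    (hN : Tendsto N atTop atTop)
    (hNp : ∀ n, |(N n : ℝ) - (p n : ℝ) ^ (1 - γ)| < 1)
    (hsp : ∀ n, |(s n : ℝ) - (p n : ℝ) ^ (1 - α)| < 1) :
    Tendsto
      (fun n =>
        OPHC.obsLaw (N n) (p n) 0 (OPHC.ophcReject (N n)) +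
          ⨆ x ∈ OPHC.paramSpace (p n) (N n) (s n) r,
            OPHC.obsLaw (N n) (p n) (OPHC.sparseVector x.1 x.2) (OPHC.ophcReject (N n))ᶜ)
      atTop (𝓝 0) := by
  simpa using (OPHC.tendsto_obsLaw_zero_ophcReject hN).add
    (OPHC.tendsto_iSup_obsLaw_compl_ophcReject hγ0 hγ1 hα0 hα1 hr hN hNp hsp)
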